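/- **Theorem.** Let $N\ge 3$ and consider the Hilbert space $(\mathbb{C}^2)^{\otimes N}$ of $N$ spins $1/2$ on the periodic chain with sites $j\in\mathbb{Z}/N\mathbb{Z}$. Let $\sigma_j^x,\sigma_j^y,\sigma_j^z$ be the Pauli matrices acting on site $j$, also written $X_j,Y_j,Z_j$, and let $I_j$ be the identity on site $j$. For real parameters put $$H_2=\sum_{j=1}^{N}\bigl(J^{xy}\sigma_j^x\sigma_{j+1}^y+J^{yz}\sigma_j^y\sigma_{j+1}^z\bigr),\qquad H_3=\sum_{j=1}^{N}\bigl(J^{xx}\sigma_j^x\sigma_{j+1}^x+J^{yz}\sigma_j^y\sigma_{j+1}^z\bigr).$$ For an integer $k\ge 0$, a *$k$-local conserved quantity* of a Hamiltonian $H$ is an operator $Q$ with $[Q,H]=0$ of the form $$Q=\sum_{\ell=1}^{k}\ \sum_{A^1,\dots,A^\ell}\ \sum_{j=1}^{N} q^{(\ell)}_{A^1\cdots A^\ell,\,j}\;A^1_jA^2_{j+1}\cdots A^\ell_{j+\ell-1}\;+\;q^{(0)}\,\mathbb{1},$$ with real coefficients $q^{(\ell)}_{A^1\cdots A^\ell,\,j}$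 and $q^{(0)}$, where the middle sum runs over all sequences of symbols $A^1,\dots,A^\ell\in\{X,Y,Z,I\}$ with $A^1\ne I$ and $A^\ell\neq I$. Let $k\le N/2$. 1. If $J^{xy}\neq0$ and $J^{yz}\ne0$, then every $k$-local conserved quantity $Q$ of $H_2$ is of the form $Q=aH_2+b\,\mathbb{1}$ with $a,b\in\mathbb{R}$. 2. If $J^{xx}\neq0$ and $J^{yz}\ne0$, then every $k$-local conserved quantity $Q$ of $H_3$ is of the form $Q=aH_3+b\,\mathbb{1}$ with $a,b\in\mathbb{R}$. -/

import Mathlib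

open Matrix

noncomputable section

namespace SpinChain

/-- The symbols `I, X, Y, Z` that label the one-site operators. -/
inductive PauliSymbol
  | I | X | Y | Z
  deriving DecidableEq

instance : Fintype PauliSymbol where
  elems := {.I, .X, .Y, .Z}
  complete A := by cases A <;> decide

/-- The `2 × 2` matrix of a symbol, in the eigenbasis `|0⟩, |1⟩` of `σ^z`. -/
def PauliSymbol.toMatrix : PauliSymbol → Matrix (Fin 2) (Fin 2) ℂ
  | .I => 1
  | .X => !![0, 1; 1, 0]
  | .Y => !![0, -Complex.I; Complex.I, 0]
  | .Z => !![1, 0; 0, -1]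

/-- Operators on the `2 ^ N`-dimensional Hilbert space of `N` spins `1/2`, as matrices in the
computational basis, whose vectors are labelled by the configurations `ZMod N → Fin 2`. The sites
are the elements of `ZMod N`, so that the chain is periodic. -/
abbrev Operator (N : ℕ) : Type := Matrix (ZMod N → Fin 2) (ZMod N → Fin 2) ℂ

/-- The tensor product over all sites `s` of the one-site operators `M s`. -/
def tensorOp {N : ℕ} [NeZero N] (M : ZMod N → Matrix (Fin 2) (Fin 2) ℂ) : Operator N :=
  Matrix.of fun σ τ => ∏ s, M s (σ s) (τ s)

/-- The operator that acts as the symbol `A` on the site `j` and as the identity elsewhere. -/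
def siteOp {N : ℕ} [NeZero N] (A : PauliSymbol) (j : ZMod N) : Operator N :=
  tensorOp (Function.update (fun _ => 1) j A.toMatrix)

/-- `∑ j, (Jxy σ^x_j σ^y_{j+1} + Jyz σ^y_j σ^z_{j+1})`. -/
def hamiltonian2 (N : ℕ) [NeZero N] (Jxy Jyz : ℝ) : Operator N :=
  ∑ j : ZMod N, ((Jxy : ℂ) • (siteOp .X j * siteOp .Y (j + 1))
    + (Jyz : ℂ) • (siteOp .Y j * siteOp .Z (j + 1)))

/-- `∑ j, (Jxx σ^x_j σ^x_{j+1} + Jyz σ^y_j σ^z_{j+1})`. -/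
def hamiltonian3 (N : ℕ) [NeZero N] (Jxx Jyz : ℝ) : Operator N :=
  ∑ j : ZMod N, ((Jxx : ℂ) • (siteOp .X j * siteOp .X (j + 1))
    + (Jyz : ℂ) • (siteOp .Y j * siteOp .Z (j + 1)))

/-- The sequences `A¹, …, A^ℓ` of symbols whose first and last members are not `I`. -/
def sequences (ℓ : ℕ) : Finset (Fin ℓ → PauliSymbol) :=
  {A | ∀ i : Fin ℓ, (i.val = 0 ∨ i.val + 1 = ℓ) → A i ≠ .I}

/-- The product `A¹_j A²_{j+1} ⋯ A^ℓ_{j+ℓ-1}`. -/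
def stringOp {N : ℕ} [NeZero N] {ℓ : ℕ} (A : Fin ℓ → PauliSymbol) (j : ZMod N) : Operator N :=
  (List.ofFn fun i : Fin ℓ => siteOp (A i) (j + (i.val : ZMod N))).prod

/-- Real linear combinations of the identity and of the strings of length at most `k`. -/
def IsLocal {N : ℕ} [NeZero N] (k : ℕ) (Q : Operator N) : Prop :=
  ∃ (q : (ℓ : ℕ) → (Fin ℓ → PauliSymbol) → ZMod N → ℝ) (q₀ : ℝ),
    Q = (∑ ℓ ∈ Finset.Icc 1 k, ∑ A ∈ sequences ℓ, ∑ j : ZMod N, (q ℓ A j : ℂ) • stringOp A j)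
      + (q₀ : ℂ) • (1 : Operator N)

/-- `Q` is a `k`-local conserved quantity of the Hamiltonian `H`. -/
def IsLocalConserved {N : ℕ} [NeZero N] (k : ℕ) (H Q : Operator N) : Prop :=
  IsLocal k Q ∧ ⁅Q, H⁆ = 0

end SpinChain

end

/-!
Expand `Q` in tensor products of Pauli matrices: `[Q, H] = 0` becomes one linear equation in the
coefficients of `Q` for every such product. After a rotation of the axes both Hamiltonians have the
form `∑ s, (J₁ X_s Y_{s+1} + J₂ w_s Z_{s+1})` with `w` equal to `Y` or `Z`.

Let `k` be the length of the longest strings in `Q`. The equation of a string of length `k + 1` can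
involve strings of length `k` only through its two end bonds, so it relates the coefficients of two
strings of length `k` that are shifted by one site. Shifting again and again shows that a string
with an inner identity has coefficient `0`, and that all the others are controlled by the
coefficient `q` of `X Z ⋯ Z Y`.

If `3 ≤ k`, then `q = 0` by the equations of the strings of length `k` with one inner identity. The
shifts link those equations into a chain along which the identity moves from the second letter to
the last but one. Every link adds a term proportional to `q`, always with the same sign, and in the
last equation nothing balances their sum.

Hence `Q` is `2`-local, and one subtracts the right multiples of `H` and of the identity.
-/

namespace SpinChain

namespace PauliSymbol

/-- The symbol of the product of the matrices of two symbols, the phase being disregarded. -/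
protected def mul : PauliSymbol → PauliSymbol → PauliSymbol
  | I, B => B
  | A, I => A
  | X, Y | Y, X => Z
  | Y, Z | Z, Y => X
  | Z, X | X, Z => Y
  | _, _ => I

/-- Klein's four-group on the symbols. Its unit is the symbol `I`, which is written `1` from here
on. -/
instance : CommGroup PauliSymbol where
  one := I
  mul := PauliSymbol.mul
  inv := id
  mul_assoc := by decide
  one_mul := by decide
  mul_one := by decide
  inv_mul_cancel := by decide
  mul_comm := by decide

/-- The Levi-Civita sign of two symbols: `A B = ± i (A * B)` if their matrices anticommute, and `0`
if they commute. -/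
def sgn : PauliSymbol → PauliSymbol → ℤ
  | X, Y | Y, Z | Z, X => 1
  | Y, X | Z, Y | X, Z => -1
  | _, _ => 0

/-- The phase in the product of the matrices of two symbols: `1` if they commute, `± i` if they
anticommute. -/
noncomputable def phase (A B : PauliSymbol) : ℂ :=
  (1 - sgn A B ^ 2) + sgn A B * Complex.I

/-- The real number `r` in `[A ⊗ B, C ⊗ D] = 2 i r (A * C) ⊗ (B * D)`. -/
def pairSign (A B C D : PauliSymbol) : ℤ :=
  sgn A C * (1 - sgn B D ^ 2) + (1 - sgn A C ^ 2) * sgn B D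

variable (A B C D : PauliSymbol)

theorem mul_self : A * A = 1 := by revert A; decide

theorem mul_mul_self : A * B * B = A := by rw [mul_assoc, mul_self, mul_one]

variable {A B} in
theorem mul_eq_one : A * B = 1 ↔ A = B := by revert A B; decide

variable {A B C} in
theorem eq_or_eq_or_eq_mul (hA : A ≠ 1) (hB : B ≠ 1) (hAB : A ≠ B) (hC : C ≠ 1) :
    C = A ∨ C = B ∨ C = A * B := by
  revert A B C; decide

theorem sgn_swap : sgn A B = -sgn B A := by revert A B; decide

theorem sgn_self : sgn A A = 0 := by revert A; decide

theorem sgn_one_left : sgn 1 A = 0 := by revert A; decide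

theorem sgn_one_right : sgn A 1 = 0 := by revert A; decide

theorem sgn_mul_self : sgn B (A * B) = sgn A B := by revert A B; decide

variable {A B} in
theorem sgn_ne_zero (hA : A ≠ 1) (hB : B ≠ 1) (h : A ≠ B) : sgn A B ≠ 0 := by
  revert A B; decide

theorem pairSign_self_left : pairSign A B A D = sgn B D := by simp [pairSign, sgn_self]

theorem pairSign_one_left : pairSign A B 1 D = sgn B D := by simp [pairSign, sgn_one_right]

theorem pairSign_self_right : pairSign A B C B = sgn A C := by simp [pairSign, sgn_self]

theorem pairSign_one_right : pairSign A B C 1 = sgn A C := by simp [pairSign, sgn_one_right]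

theorem phase_self : phase A A = 1 := by simp [phase, sgn_self]

theorem phase_one_left : phase 1 A = 1 := by simp [phase, sgn_one_left]

theorem phase_one_right : phase A 1 = 1 := by simp [phase, sgn_one_right]

theorem phase_mul_phase_sub :
    phase A C * phase B D - phase C A * phase D B = 2 * Complex.I * pairSign A B C D := by
  rw [phase, phase, phase, phase, pairSign, sgn_swap C A, sgn_swap D B]
  push_cast
  ring

theorem toMatrix_one : (1 : PauliSymbol).toMatrix = 1 := rfl

theorem toMatrix_mul : A.toMatrix * B.toMatrix = phase A B • (A * B).toMatrix := by
  change _ = phase A B • (PauliSymbol.mul A B).toMatrix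
  ext i j
  cases A <;> cases B <;> fin_cases i <;> fin_cases j <;>
    simp [toMatrix, phase, sgn, PauliSymbol.mul]

theorem trace_toMatrix : A.toMatrix.trace = if A = 1 then 2 else 0 := by
  cases A
  case I => simp [toMatrix, show I = 1 from rfl]
  all_goals
    rw [if_neg (by decide)]
    simp [toMatrix, Matrix.trace]

end PauliSymbol

section Sites

variable {N : ℕ}

theorem ne_add_one (hN : 2 ≤ N) (s : ZMod N) : s ≠ s + 1 := by
  have : Fact (1 < N) := ⟨hN⟩
  simp

theorem add_natCast_inj {a b : ℕ} (ha : a < N) (hb : b < N) (j : ZMod N) :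
    j + a = j + b ↔ a = b := by
  rw [add_right_inj, ZMod.natCast_eq_natCast_iff', Nat.mod_eq_of_lt ha, Nat.mod_eq_of_lt hb]

variable [NeZero N]

theorem exists_eq_add_natCast (j s : ZMod N) : ∃ i < N, s = j + (i : ℕ) :=
  ⟨(s - j).val, ZMod.val_lt _, by simp⟩

theorem sum_eq_sum_range {M : Type*} [AddCommMonoid M] (f : ZMod N → M) (j : ZMod N) :
    ∑ s, f s = ∑ i ∈ Finset.range N, f (j + (i : ℕ)) := by
  symm
  refine Finset.sum_bij (fun i _ => j + (i : ℕ)) (fun _ _ => Finset.mem_univ _) ?_ ?_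
    fun _ _ => rfl
  · intro a ha b hb h
    exact (add_natCast_inj (Finset.mem_range.1 ha) (Finset.mem_range.1 hb) j).1 h
  · intro s _
    obtain ⟨i, hi, rfl⟩ := exists_eq_add_natCast j s
    exact ⟨i, Finset.mem_range.2 hi, rfl⟩

theorem apply_eq_of_add_one_eq {α : Type*} {f : ZMod N → α}
    (h : ∀ j, f (j + 1) = f j) (i j : ZMod N) : f i = f j := by
  obtain ⟨n, -, rfl⟩ := exists_eq_add_natCast j i
  induction n with
  | zero => rw [Nat.cast_zero, add_zero]
  | succ n ih => rw [Nat.cast_succ, ← add_assoc, h, ih]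

end Sites

/-- A symbol for every site, which labels a tensor product of one-site operators. -/
abbrev Config (N : ℕ) : Type := ZMod N → PauliSymbol

/-- The configuration with the symbols of the word `l` on the sites `j, j + 1, …` and `1` on all
other sites. -/
def place {N : ℕ} (j : ZMod N) : List PauliSymbol → Config N
  | [] => 1
  | A :: l => Pi.mulSingle j A * place (j + 1) l

section Place

variable {N : ℕ}

theorem place_append (j : ZMod N) (l₁ l₂ : List PauliSymbol) :
    place j (l₁ ++ l₂) = place j l₁ * place (j + (l₁.length : ZMod N)) l₂ := by
  induction l₁ generalizing j with
  | nil => simp [place]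
  | cons A l ih =>
    rw [List.cons_append, place, ih, place, mul_assoc, List.length_cons]
    push_cast
    rw [add_assoc, add_comm (1 : ZMod N)]

theorem place_one_cons (j : ZMod N) (l : List PauliSymbol) :
    place j (1 :: l) = place (j + 1) l := by
  rw [place, Pi.mulSingle_one, one_mul]

theorem place_append_one (j : ZMod N) (l : List PauliSymbol) : place j (l ++ [1]) = place j l := by
  rw [place_append, place_one_cons, place, mul_one]

theorem place_mul_pair (j : ZMod N) (l₁ l₂ : List PauliSymbol) (A B u e : PauliSymbol) :
    place j (l₁ ++ A :: B :: l₂) * place (j + (l₁.length : ZMod N)) [u, e] =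
      place j (l₁ ++ (A * u) :: (B * e) :: l₂) := by
  simp only [place_append, place, Pi.mulSingle_mul, mul_one]
  ac_rfl

theorem place_pair_left (hN : 2 ≤ N) (A B : PauliSymbol) (s : ZMod N) :
    place s [A, B] s = A := by
  simp [place, ne_add_one hN s]

theorem place_pair_right (hN : 2 ≤ N) (A B : PauliSymbol) (s : ZMod N) :
    place s [A, B] (s + 1) = B := by
  simp [place, (ne_add_one hN s).symm]

theorem place_pair_of_ne (A B : PauliSymbol) {s t : ZMod N} (h : t ≠ s) (h' : t ≠ s + 1) :
    place s [A, B] t = 1 := by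
  simp [place, h, h']

theorem place_map (f : PauliSymbol →* PauliSymbol) (j : ZMod N) (l : List PauliSymbol) :
    place j (l.map f) = f ∘ place j l := by
  induction l generalizing j with
  | nil => funext; simp [place]
  | cons A l ih =>
    funext s
    rw [List.map_cons, place, ih, place, Pi.mul_apply, Function.comp_apply, Function.comp_apply,
      Pi.mul_apply, map_mul, Pi.apply_mulSingle (fun _ => f) fun _ => map_one f]

theorem place_apply {l : List PauliSymbol} (hl : l.length ≤ N) (j : ZMod N) {i : ℕ} (hi : i < N) :
    place j l (j + i) = l.getD i 1 := by
  induction l generalizing j i with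
  | nil => rfl
  | cons A l ih =>
    rw [List.length_cons] at hl
    rw [place, Pi.mul_apply]
    cases i with
    | zero =>
      have hlast : j + (0 : ℕ) = j + 1 + (N - 1 : ℕ) := by
        rw [Nat.cast_sub (by omega)]
        simp
      rw [hlast, ih (by omega) _ (by omega), ← hlast]
      simp [List.getElem?_eq_none (by omega : l.length ≤ N - 1)]
    | succ i =>
      have hne : j + (i + 1 : ℕ) ≠ j := by
        simpa using (add_natCast_inj hi (by omega : 0 < N) j).not.2 i.succ_ne_zero
      rw [Pi.mulSingle_eq_of_ne hne, one_mul, Nat.cast_succ, add_comm (i : ZMod N), ← add_assoc,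
        ih (by omega) _ (by omega)]
      rfl

theorem place_succ_self {l : List PauliSymbol} (hl : l.length < N) (j : ZMod N) :
    place (j + 1) l j = 1 := by
  simpa [place_one_cons] using place_apply (l := 1 :: l) hl j (Nat.zero_lt_of_lt hl)

theorem place_cons_self {l : List PauliSymbol} (hl : l.length < N) (A : PauliSymbol)
    (j : ZMod N) : place j (A :: l) j = A := by
  simpa using place_apply (l := A :: l) hl j (Nat.zero_lt_of_lt hl)

theorem place_append_singleton_apply {l : List PauliSymbol} (hl : l.length < N) (E : PauliSymbol)
    (j : ZMod N) : place j (l ++ [E]) (j + (l.length : ZMod N)) = E := by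
  simpa using place_apply (l := l ++ [E]) (by simpa) j hl

end Place

section Operators

variable {N : ℕ} [NeZero N]

theorem tensorOp_mul (M M' : ZMod N → Matrix (Fin 2) (Fin 2) ℂ) :
    tensorOp M * tensorOp M' = tensorOp fun s => M s * M' s := by
  ext σ τ
  simp only [tensorOp, Matrix.mul_apply, Matrix.of_apply, ← Finset.prod_mul_distrib,
    Finset.prod_univ_sum, Fintype.piFinset_univ]

theorem trace_tensorOp (M : ZMod N → Matrix (Fin 2) (Fin 2) ℂ) :
    (tensorOp M).trace = ∏ s, (M s).trace := by
  simp only [tensorOp, Matrix.trace, Matrix.diag_apply, Matrix.of_apply, Finset.prod_univ_sum,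
    Fintype.piFinset_univ]

/-- The tensor product over all sites `s` of the matrices of the symbols `P s`. -/
noncomputable def pauliOp (P : Config N) : Operator N := tensorOp fun s => (P s).toMatrix

theorem pauliOp_mul (P R : Config N) :
    pauliOp P * pauliOp R = (∏ s, (P s).phase (R s)) • pauliOp (P * R) := by
  ext σ τ
  rw [pauliOp, pauliOp, tensorOp_mul]
  simp only [pauliOp, PauliSymbol.toMatrix_mul, tensorOp, Matrix.of_apply, Matrix.smul_apply,
    smul_eq_mul, Finset.prod_mul_distrib, Pi.mul_apply]

theorem pauliOp_mul_of_disjoint {P R : Config N} (h : ∀ s, P s = 1 ∨ R s = 1) :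
    pauliOp P * pauliOp R = pauliOp (P * R) := by
  rw [pauliOp_mul, Finset.prod_eq_one, one_smul]
  intro s _
  rcases h s with h | h <;> rw [h]
  exacts [PauliSymbol.phase_one_left _, PauliSymbol.phase_one_right _]

theorem pauliOp_one : pauliOp (1 : Config N) = 1 := by
  ext σ τ
  simp only [pauliOp, tensorOp, Pi.one_apply, PauliSymbol.toMatrix_one, Matrix.of_apply,
    Matrix.one_apply, Finset.prod_ite_zero, Finset.prod_const_one, Finset.mem_univ, true_imp_iff,
    funext_iff]

theorem trace_pauliOp (P : Config N) : (pauliOp P).trace = if P = 1 then 2 ^ N else 0 := by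
  simp only [pauliOp, trace_tensorOp, PauliSymbol.trace_toMatrix, Finset.prod_ite_zero,
    Finset.mem_univ, true_imp_iff, Finset.prod_const, Finset.card_univ, ZMod.card, funext_iff,
    Pi.one_apply]

theorem siteOp_eq_pauliOp (A : PauliSymbol) (j : ZMod N) :
    siteOp A j = pauliOp (Pi.mulSingle j A) := by
  have h (s : ZMod N) :=
    Function.apply_update (fun _ => PauliSymbol.toMatrix) (1 : Config N) j A s
  exact congrArg tensorOp (funext fun s => (h s).symm)

theorem pauliOp_place_cons {l : List PauliSymbol} (hl : l.length < N) (A : PauliSymbol)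
    (j : ZMod N) : pauliOp (place j (A :: l)) = siteOp A j * pauliOp (place (j + 1) l) := by
  rw [siteOp_eq_pauliOp, pauliOp_mul_of_disjoint, place]
  intro s
  rcases eq_or_ne s j with rfl | hs
  · exact .inr (place_succ_self hl s)
  · exact .inl (Pi.mulSingle_eq_of_ne hs _)

theorem siteOp_mul_siteOp (hN : 2 ≤ N) (A B : PauliSymbol) (s : ZMod N) :
    siteOp A s * siteOp B (s + 1) = pauliOp (place s [A, B]) := by
  rw [pauliOp_place_cons (by simpa), pauliOp_place_cons (by simpa using NeZero.pos N), place,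
    pauliOp_one, mul_one]

theorem stringOp_eq_pauliOp {ℓ : ℕ} (hℓ : ℓ ≤ N) (A : Fin ℓ → PauliSymbol) (j : ZMod N) :
    stringOp A j = pauliOp (place j (List.ofFn A)) := by
  induction ℓ generalizing j with
  | zero => simp [stringOp, place, pauliOp_one]
  | succ ℓ ih =>
    rw [List.ofFn_succ, pauliOp_place_cons (by simpa), ← ih (by omega), stringOp, stringOp,
      List.ofFn_succ, List.prod_cons]
    simp only [Fin.val_zero, Nat.cast_zero, add_zero, Fin.val_succ, Nat.cast_succ, add_assoc,
      add_comm (1 : ZMod N)]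

theorem prod_pair {M : Type*} [CommMonoid M] (hN : 2 ≤ N) (f : PauliSymbol → PauliSymbol → M)
    (hf : ∀ A, f 1 A = 1) (A B : PauliSymbol) (s : ZMod N) (R : Config N) :
    ∏ t, f (place s [A, B] t) (R t) = f A (R s) * f B (R (s + 1)) := by
  rw [Fintype.prod_eq_mul s (s + 1) (ne_add_one hN s) fun t ht => by
    rw [place_pair_of_ne A B ht.1 ht.2, hf], place_pair_left hN, place_pair_right hN]

theorem lie_pauliOp_pair (hN : 2 ≤ N) (A B : PauliSymbol) (s : ZMod N) (R : Config N) :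
    ⁅pauliOp (place s [A, B]), pauliOp R⁆ =
      (2 * Complex.I * (A.pairSign B (R s) (R (s + 1)) : ℝ) : ℂ) •
        pauliOp (R * place s [A, B]) := by
  rw [Ring.lie_def, pauliOp_mul, pauliOp_mul, mul_comm R, ← sub_smul,
    prod_pair hN PauliSymbol.phase PauliSymbol.phase_one_left,
    prod_pair hN (fun A B => B.phase A) PauliSymbol.phase_one_right,
    PauliSymbol.phase_mul_phase_sub]
  norm_cast

/-- The linear combination of the tensor products of symbols with the coefficients `c`. -/
noncomputable def toOp : (Config N → ℝ) →ₗ[ℝ] Operator N := Fintype.linearCombination ℝ pauliOp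

theorem toOp_single (P : Config N) : toOp (Pi.single P 1) = pauliOp P := by
  rw [toOp, Fintype.linearCombination_apply_single, one_smul]

theorem trace_toOp_mul_pauliOp (c : Config N → ℝ) (P : Config N) :
    (toOp c * pauliOp P).trace = 2 ^ N * c P := by
  have hterm (R : Config N) : (c R • pauliOp R * pauliOp P).trace =
      if R = P then (2 ^ N * c P : ℂ) else 0 := by
    rw [smul_mul_assoc, Matrix.trace_smul, pauliOp_mul, Matrix.trace_smul, trace_pauliOp]
    have hmul : R * P = 1 ↔ R = P := by
      simp only [funext_iff, Pi.mul_apply, Pi.one_apply, PauliSymbol.mul_eq_one]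
    rw [if_congr hmul rfl rfl]
    split_ifs with h
    · rw [h, Finset.prod_eq_one fun s _ => PauliSymbol.phase_self _, one_smul, Complex.real_smul,
        mul_comm]
    · rw [smul_zero, smul_zero]
  rw [toOp, Fintype.linearCombination_apply, Finset.sum_mul, Matrix.trace_sum,
    Fintype.sum_congr _ _ hterm, Finset.sum_ite_eq' Finset.univ, if_pos (Finset.mem_univ P)]

end Operators

section Hamiltonian

variable {N : ℕ} [NeZero N]

/-- The translation-invariant nearest-neighbour Hamiltonian with the coupling `J A B` of `A` on a
site to `B` on the next one. -/
noncomputable def nnHamiltonian (N : ℕ) [NeZero N] (J : PauliSymbol → PauliSymbol → ℝ) :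
    Operator N :=
  ∑ s : ZMod N, ∑ A, ∑ B, J A B • (siteOp A s * siteOp B (s + 1))

/-- The contribution of the bond `s, s + 1` to the coefficient of `R` in the commutator of
`nnHamiltonian N J` with `toOp c`, up to a constant factor. -/
noncomputable def bondTerm (J : PauliSymbol → PauliSymbol → ℝ) (c : Config N → ℝ) (R : Config N)
    (s : ZMod N) : ℝ :=
  ∑ A, ∑ B, J A B * A.pairSign B (R s) (R (s + 1)) * c (R * place s [A, B])

/-- `toOp c` commutes with `nnHamiltonian N J`, in terms of coefficients. -/
def IsStationary (J : PauliSymbol → PauliSymbol → ℝ) (c : Config N → ℝ) : Prop :=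
  ∀ R, ∑ s, bondTerm J c R s = 0

/-- The coefficients of `nnHamiltonian N J`. -/
noncomputable def nnCoeff (N : ℕ) [NeZero N] (J : PauliSymbol → PauliSymbol → ℝ) :
    Config N → ℝ :=
  ∑ s : ZMod N, ∑ A, ∑ B, J A B • Pi.single (place s [A, B]) 1

theorem toOp_nnCoeff (hN : 2 ≤ N) (J : PauliSymbol → PauliSymbol → ℝ) :
    toOp (nnCoeff N J) = nnHamiltonian N J := by
  simp only [nnCoeff, nnHamiltonian, map_sum, map_smul, toOp_single, siteOp_mul_siteOp hN]

theorem trace_lie_pair_mul_pauliOp (hN : 2 ≤ N) (c : Config N → ℝ) (A B : PauliSymbol)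
    (s : ZMod N) (R : Config N) :
    (⁅toOp c, pauliOp (place s [A, B])⁆ * pauliOp R).trace =
      2 ^ N * (2 * Complex.I) *
        (A.pairSign B (R s) (R (s + 1)) * c (R * place s [A, B]) : ℝ) := by
  have hcycle (Q T P : Operator N) : (⁅Q, T⁆ * P).trace = (Q * ⁅T, P⁆).trace := by
    simp only [Ring.lie_def, sub_mul, mul_sub, Matrix.trace_sub, Matrix.mul_assoc]
    rw [Matrix.trace_mul_comm T, Matrix.mul_assoc]
  rw [hcycle, lie_pauliOp_pair hN, Matrix.mul_smul, Matrix.trace_smul, trace_toOp_mul_pauliOp]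
  push_cast
  ring

theorem IsStationary.of_lie_eq_zero (hN : 2 ≤ N) {J : PauliSymbol → PauliSymbol → ℝ}
    {c : Config N → ℝ} (h : ⁅toOp c, nnHamiltonian N J⁆ = 0) : IsStationary J c := by
  intro R
  have htrace : (⁅toOp c, nnHamiltonian N J⁆ * pauliOp R).trace =
      2 ^ N * (2 * Complex.I) * (∑ s, bondTerm J c R s : ℝ) := by
    simp only [nnHamiltonian, siteOp_mul_siteOp hN, Ring.lie_def, Finset.mul_sum, Finset.sum_mul,
      ← Finset.sum_sub_distrib, Matrix.mul_smul, Matrix.smul_mul, ← smul_sub]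
    simp only [← Ring.lie_def, Matrix.trace_sum, Matrix.trace_smul, trace_lie_pair_mul_pauliOp hN,
      bondTerm, Complex.ofReal_sum, Finset.mul_sum, Complex.real_smul, Complex.ofReal_mul,
      Complex.ofReal_intCast]
    simp only [mul_assoc, mul_left_comm (Complex.ofReal _)]
  rw [h, zero_mul, Matrix.trace_zero, eq_comm, mul_eq_zero] at htrace
  exact_mod_cast htrace.resolve_left (by simp)

end Hamiltonian

section Local

variable {N k : ℕ}

/-- The coefficient functions that are supported on the configurations which are `1` outside some
`k` consecutive sites. -/
def localCoeffs (N k : ℕ) : Submodule ℝ (Config N → ℝ) :=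
  Submodule.pi {P | ∃ a l, l.length ≤ k ∧ place a l = P}ᶜ fun _ => ⊥

theorem mem_localCoeffs {c : Config N → ℝ} :
    c ∈ localCoeffs N k ↔ ∀ P, c P ≠ 0 → ∃ a l, l.length ≤ k ∧ place a l = P := by
  simp only [localCoeffs, Submodule.mem_pi, Set.mem_compl_iff, Set.mem_ofPred_eq, Submodule.mem_bot]
  exact forall_congr' fun P => not_imp_comm

theorem single_place_mem_localCoeffs [NeZero N] {l : List PauliSymbol} (hl : l.length ≤ k)
    (a : ZMod N) : Pi.single (place a l) 1 ∈ localCoeffs N k := by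
  refine mem_localCoeffs.2 fun P hP => ⟨a, l, hl, ?_⟩
  by_contra h
  exact hP (Pi.single_eq_of_ne' h _)

theorem localCoeffs_mono {k' : ℕ} (h : k ≤ k') : localCoeffs N k ≤ localCoeffs N k' :=
  fun _ hc => mem_localCoeffs.2 fun P hP =>
    let ⟨a, l, hl, hP⟩ := mem_localCoeffs.1 hc P hP
    ⟨a, l, hl.trans h, hP⟩

theorem IsLocal.mem_map_localCoeffs [NeZero N] (hk : k ≤ N) {Q : Operator N} (hQ : IsLocal k Q) :
    Q ∈ (localCoeffs N k).map toOp := by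
  have hplace {l : List PauliSymbol} (hl : l.length ≤ k) (a : ZMod N) :
      pauliOp (place a l) ∈ (localCoeffs N k).map toOp :=
    ⟨_, single_place_mem_localCoeffs hl a, toOp_single _⟩
  obtain ⟨q, q₀, rfl⟩ := hQ
  simp only [Complex.coe_smul]
  refine add_mem (sum_mem fun ℓ hℓ => sum_mem fun A _ => sum_mem fun j _ =>
    Submodule.smul_mem _ _ ?_) (Submodule.smul_mem _ _ ?_)
  · have hℓk : ℓ ≤ k := (Finset.mem_Icc.1 hℓ).2
    rw [stringOp_eq_pauliOp (hℓk.trans hk)]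
    exact hplace (by simpa) j
  · rw [← pauliOp_one]
    exact hplace (l := []) k.zero_le 0

theorem exists_eq_cons_append_singleton {l : List PauliSymbol} (hl : 2 ≤ l.length) :
    ∃ A m D, l = A :: (m ++ [D]) := by
  obtain ⟨A, l, rfl⟩ := List.exists_cons_of_length_pos (by omega : 0 < l.length)
  have hne : l ≠ [] := by rintro rfl; simp at hl
  exact ⟨A, l.dropLast, l.getLast hne, by rw [List.dropLast_append_getLast]⟩

theorem mem_localCoeffs_pred (hk : 2 ≤ k) {c : Config N → ℝ} (hc : c ∈ localCoeffs N k)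
    (h : ∀ j A m D, A ≠ 1 → D ≠ 1 → m.length + 2 = k → c (place j (A :: (m ++ [D]))) = 0) :
    c ∈ localCoeffs N (k - 1) := by
  refine mem_localCoeffs.2 fun P hP => ?_
  obtain ⟨a, l, hl, rfl⟩ := mem_localCoeffs.1 hc P hP
  rcases Nat.lt_or_ge l.length k with hlk | hkl
  · exact ⟨a, l, by omega, rfl⟩
  obtain ⟨A, m, D, rfl⟩ := exists_eq_cons_append_singleton (hk.trans hkl)
  simp only [List.length_cons, List.length_append, List.length_nil] at hl hkl
  by_cases hA : A = 1
  · exact ⟨a + 1, m ++ [D], by simp; omega, by rw [hA, place_one_cons]⟩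
  by_cases hD : D = 1
  · exact ⟨a, A :: m, by simp; omega, by rw [hD, ← List.cons_append, place_append_one]⟩
  exact absurd (h a A m D hA hD (by omega)) hP

theorem lt_length_of_place_ne_one {l : List PauliSymbol} (hl : l.length ≤ N) {a : ZMod N} {i : ℕ}
    (hi : i < N) (h : place a l (a + i) ≠ 1) : i < l.length := by
  by_contra! hle
  exact h (by rw [place_apply hl a hi, List.getD_eq_default _ _ hle])

variable [NeZero N]

theorem exists_place_of_ne_one (hkN : 2 * k ≤ N) {c : Config N → ℝ} (hc : c ∈ localCoeffs N k)
    {P : Config N} (hP : c P ≠ 0) {s : ZMod N} {d : ℕ} (hd : d ≤ k) (hs : P s ≠ 1)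
    (hsd : P (s + d) ≠ 1) :
    ∃ a l, ∃ i : ℕ, l.length ≤ k ∧ place a l = P ∧ s = a + i ∧ i + d < l.length := by
  obtain ⟨a, l, hl, rfl⟩ := mem_localCoeffs.1 hc P hP
  obtain ⟨i, hi, rfl⟩ := exists_eq_add_natCast a s
  have hil := lt_length_of_place_ne_one (by omega) hi hs
  rw [add_assoc, ← Nat.cast_add] at hsd
  exact ⟨a, l, i, hl, rfl, rfl, lt_length_of_place_ne_one (by omega) (by omega) hsd⟩

theorem eq_zero_of_ne_one (hkN : 2 * k ≤ N) {c : Config N → ℝ} (hc : c ∈ localCoeffs N k)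
    {P : Config N} {s : ZMod N} (hs : P s ≠ 1) (hsk : P (s + k) ≠ 1) : c P = 0 := by
  by_contra hP
  obtain ⟨a, l, i, hl, -, -, hi⟩ := exists_place_of_ne_one hkN hc hP le_rfl hs hsk
  omega

theorem exists_word (hk : 2 ≤ k) (hkN : 2 * k ≤ N) {c : Config N → ℝ} (hc : c ∈ localCoeffs N k)
    {P : Config N} (hP : c P ≠ 0) {a : ZMod N} (ha : P a ≠ 1) (hak : P (a + (k - 1 : ℕ)) ≠ 1) :
    ∃ A m D, A ≠ 1 ∧ D ≠ 1 ∧ m.length + 2 = k ∧ P = place a (A :: (m ++ [D])) := by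
  obtain ⟨b, l, i, hl, rfl, rfl, hi⟩ := exists_place_of_ne_one hkN hc hP (k.sub_le 1) ha hak
  obtain rfl : i = 0 := by omega
  obtain ⟨A, m, D, rfl⟩ := exists_eq_cons_append_singleton (by omega : 2 ≤ l.length)
  have hlen : m.length + 2 = k := by
    simp only [List.length_cons, List.length_append, List.length_nil] at hl hi
    omega
  have hN : (A :: m).length < N := by simp; omega
  rw [Nat.cast_zero, add_zero] at ha hak ⊢
  rw [place_cons_self (by simp; omega)] at ha
  rw [show k - 1 = (A :: m).length by simp; omega, ← List.cons_append,
    place_append_singleton_apply hN] at hak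
  exact ⟨A, m, D, ha, hak, hlen, rfl⟩

end Local

section BondTerm

variable {N : ℕ} {J : PauliSymbol → PauliSymbol → ℝ} {c : Config N → ℝ}

theorem bondTerm_eq_zero (hN : 2 ≤ N) {R : Config N} {a b s : ZMod N} (ha : R a ≠ 1)
    (hb : R b ≠ 1) (ha' : R (a - 1) = 1) (hb' : R (b + 1) = 1) (hsa : s ≠ a) (hsb : s + 1 ≠ b)
    (h : ∀ P : Config N, P a ≠ 1 → P b ≠ 1 → (∀ t, t ≠ s → t ≠ s + 1 → P t = R t) → c P = 0) :
    bondTerm J c R s = 0 := by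
  refine Finset.sum_eq_zero fun u _ => Finset.sum_eq_zero fun e _ => ?_
  by_cases hsgn : u.pairSign e (R s) (R (s + 1)) = 0
  · simp [hsgn]
  have hoff (t : ZMod N) (ht : t ≠ s) (ht' : t ≠ s + 1) : (R * place s [u, e]) t = R t := by
    rw [Pi.mul_apply, place_pair_of_ne u e ht ht', mul_one]
  rw [h _ ?_ ?_ hoff, mul_zero]
  · by_cases has : a = s + 1
    · rintro h1
      rw [has, Pi.mul_apply, place_pair_right hN, PauliSymbol.mul_eq_one] at h1
      refine hsgn ?_
      rw [← h1, eq_sub_of_add_eq has.symm, ha', PauliSymbol.pairSign_self_right,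
        PauliSymbol.sgn_one_right]
    · rwa [hoff a hsa.symm has]
  · by_cases hbs : b = s
    · rintro h1
      rw [hbs, Pi.mul_apply, place_pair_left hN, PauliSymbol.mul_eq_one] at h1
      refine hsgn ?_
      rw [← h1, ← hbs, hb', PauliSymbol.pairSign_self_left, PauliSymbol.sgn_one_right]
    · rwa [hoff b hbs hsb.symm]

theorem bondTerm_place {l₁ l₂ : List PauliSymbol} (hl : l₁.length + l₂.length + 2 ≤ N)
    (j : ZMod N) (A B : PauliSymbol) :
    bondTerm J c (place j (l₁ ++ A :: B :: l₂)) (j + (l₁.length : ZMod N)) =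
      ∑ u, ∑ e, J u e * u.pairSign e A B * c (place j (l₁ ++ (A * u) :: (B * e) :: l₂)) := by
  have hlen : (l₁ ++ A :: B :: l₂).length ≤ N := by simp; omega
  have hA : place j (l₁ ++ A :: B :: l₂) (j + (l₁.length : ZMod N)) = A := by
    rw [place_apply hlen j (by omega)]
    simp
  have hB : place j (l₁ ++ A :: B :: l₂) (j + (l₁.length : ZMod N) + 1) = B := by
    rw [add_assoc, ← Nat.cast_succ, place_apply hlen j (by omega)]
    simp
  simp only [bondTerm, hA, hB, place_mul_pair]

theorem bondTerm_word_eq_zero {l : List PauliSymbol} (hl : l.length + 2 < N) {j s : ZMod N}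
    {A E : PauliSymbol} (hA : A ≠ 1) (hE : E ≠ 1) (hfirst : s ≠ j)
    (hlast : s ≠ j + (l.length : ZMod N))
    (h : ∀ P : Config N, P j ≠ 1 → P (j + ((l.length + 1 : ℕ) : ZMod N)) ≠ 1 →
      (∀ t, t ≠ s → t ≠ s + 1 → P t = place j (A :: (l ++ [E])) t) → c P = 0) :
    bondTerm J c (place j (A :: (l ++ [E]))) s = 0 := by
  have hlen : (A :: (l ++ [E])).length < N := by simpa
  refine bondTerm_eq_zero (by omega) (b := j + ((l.length + 1 : ℕ) : ZMod N)) ?_ ?_ ?_ ?_ hfirst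
    ?_ h
  · rwa [place_cons_self (by simp; omega)]
  · rw [← List.cons_append]
    exact (place_append_singleton_apply (l := A :: l) (by simp; omega) E j).trans_ne hE
  · simpa using place_succ_self hlen (j - 1)
  · rw [add_assoc, ← Nat.cast_succ, place_apply hlen.le j (by omega)]
    exact List.getD_eq_default _ _ (by simp)
  · rw [Nat.cast_succ, ← add_assoc]
    exact add_left_injective 1 |>.ne hlast

/-- The contribution of the first bond of the word `A :: l` at `j` that comes from the shorter words
obtained by removing `A`. -/
noncomputable def leftTerm (J : PauliSymbol → PauliSymbol → ℝ) (c : Config N → ℝ) (j : ZMod N)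
    (A : PauliSymbol) : List PauliSymbol → ℝ
  | [] => 0
  | B :: l => ∑ e, J A e * e.sgn B * c (place (j + 1) ((B * e) :: l))

theorem leftTerm_eq_zero {j : ZMod N} {A B : PauliSymbol} {l : List PauliSymbol}
    (h : ∀ e, J A e ≠ 0 → B ≠ 1 → B ≠ e → c (place (j + 1) ((B * e) :: l)) = 0) :
    leftTerm J c j A (B :: l) = 0 := by
  refine Finset.sum_eq_zero fun e _ => ?_
  by_cases hJ : J A e = 0
  · rw [hJ, zero_mul, zero_mul]
  rcases eq_or_ne B 1 with rfl | hB
  · simp [PauliSymbol.sgn_one_right]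
  rcases eq_or_ne B e with rfl | hBe
  · simp [PauliSymbol.sgn_self]
  rw [h e hJ hB hBe, mul_zero]

theorem leftTerm_eq_single {A e : PauliSymbol} (hA : ∀ e', e' ≠ e → J A e' = 0) (j : ZMod N)
    (B : PauliSymbol) (l : List PauliSymbol) :
    leftTerm J c j A (B :: l) = J A e * e.sgn B * c (place (j + 1) ((B * e) :: l)) :=
  Fintype.sum_eq_single e fun e' he => by rw [hA e' he, zero_mul, zero_mul]

theorem leftTerm_append_eq_zero {k : ℕ} {E : PauliSymbol}
    (h : ∀ j B p, B ≠ 1 → p.length + 2 = k → c (place j (B :: (p ++ [E]))) = 0)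
    {m : List PauliSymbol} (hm : m.length + 2 = k) (j : ZMod N) (A D : PauliSymbol) :
    leftTerm J c j A (m ++ [D, E]) = 0 := by
  cases m with
  | nil =>
    refine leftTerm_eq_zero fun e _ _ hDe => ?_
    exact h (j + 1) _ [] (PauliSymbol.mul_eq_one.not.2 hDe) hm
  | cons B m =>
    refine leftTerm_eq_zero fun e _ _ hBe => ?_
    simpa using h (j + 1) _ (m ++ [D]) (PauliSymbol.mul_eq_one.not.2 hBe) (by simpa using hm)

theorem bondTerm_first {l : List PauliSymbol} (hl : l.length + 2 ≤ N) {j : ZMod N}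
    {A B : PauliSymbol} (h : ∀ u e, A * u ≠ 1 → c (place j ((A * u) :: (B * e) :: l)) = 0) :
    bondTerm J c (place j (A :: B :: l)) j = leftTerm J c j A (B :: l) := by
  have hbond := bondTerm_place (J := J) (c := c) (l₁ := []) (l₂ := l) (by simpa) j A B
  simp only [List.length_nil, Nat.cast_zero, add_zero, List.nil_append] at hbond
  rw [hbond, Fintype.sum_eq_single A fun u hu => Finset.sum_eq_zero fun e _ => by
    rw [h u e (PauliSymbol.mul_eq_one.not.2 hu.symm), mul_zero]]
  simp only [leftTerm, PauliSymbol.pairSign_self_left, PauliSymbol.mul_self, place_one_cons]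

theorem bondTerm_last {l : List PauliSymbol} (hl : l.length + 2 ≤ N) {j : ZMod N}
    {D E : PauliSymbol} (h : ∀ u e, E * e ≠ 1 → c (place j (l ++ [D * u, E * e])) = 0) :
    bondTerm J c (place j (l ++ [D, E])) (j + (l.length : ZMod N)) =
      ∑ u, J u E * u.sgn D * c (place j (l ++ [D * u])) := by
  rw [bondTerm_place (by simpa)]
  refine Fintype.sum_congr _ _ fun u => ?_
  rw [Fintype.sum_eq_single E fun e he => by
    rw [h u e (PauliSymbol.mul_eq_one.not.2 he.symm), mul_zero], PauliSymbol.pairSign_self_right,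
    PauliSymbol.mul_self, ← place_append_one j (l ++ [D * u]), List.append_assoc]
  rfl

variable {k : ℕ}

theorem eq_zero_of_length_eq_succ [NeZero N] (hkN : 2 * k ≤ N)
    (hc : c ∈ localCoeffs N k) {A E : PauliSymbol} (hA : A ≠ 1) (hE : E ≠ 1)
    {l : List PauliSymbol} (hl : l.length + 1 = k) (j : ZMod N) :
    c (place j (A :: (l ++ [E]))) = 0 := by
  refine eq_zero_of_ne_one hkN hc (s := j) ?_ ?_
  · rwa [place_cons_self (by simp; omega)]
  · rw [← List.cons_append, ← hl]
    exact (place_append_singleton_apply (l := A :: l) (by simp; omega) E j).trans_ne hE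

theorem IsStationary.leftTerm_add_eq_zero [NeZero N] (hJ : IsStationary J c) (hkN : 2 * k ≤ N)
    (hc : c ∈ localCoeffs N k) {A D E : PauliSymbol} (hA : A ≠ 1) (hE : E ≠ 1)
    {m : List PauliSymbol} (hm : m.length + 2 = k) (j : ZMod N) :
    leftTerm J c j A (m ++ [D, E]) +
      ∑ u, J u E * u.sgn D * c (place j (A :: (m ++ [D * u]))) = 0 := by
  obtain ⟨B, l, hBl⟩ : ∃ B l, m ++ [D] = B :: l := List.exists_cons_of_ne_nil (by simp)
  have hl : l.length = m.length := by simpa using (congrArg List.length hBl).symm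
  have hsplit : m ++ [D, E] = B :: (l ++ [E]) := by
    rw [← List.cons_append, ← hBl, List.append_assoc]; rfl
  have hfirst : bondTerm J c (place j (A :: (m ++ [D, E]))) j = leftTerm J c j A (m ++ [D, E]) := by
    rw [hsplit, bondTerm_first (by simp; omega)]
    intro u e hu
    exact eq_zero_of_length_eq_succ (l := (B * e) :: l) hkN hc hu hE (by simp; omega) j
  have hlast : bondTerm J c (place j (A :: (m ++ [D, E]))) (j + (m.length + 1 : ℕ)) =
      ∑ u, J u E * u.sgn D * c (place j (A :: (m ++ [D * u]))) := by
    refine bondTerm_last (l := A :: m) (by simp; omega) fun u e he => ?_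
    simpa using eq_zero_of_length_eq_succ (l := m ++ [D * u]) hkN hc hA he
      (by simp; omega) j
  rw [← hfirst, ← hlast, ← hJ (place j (A :: (m ++ [D, E])))]
  refine (Fintype.sum_eq_add j _ ?_ fun s hs => ?_).symm
  · simpa using (add_natCast_inj (by omega : 0 < N) (by omega : m.length + 1 < N) j).not.2
      (by simp)
  · have hk : (B :: l).length + 1 = k := by simp; omega
    rw [hsplit]
    refine bondTerm_word_eq_zero (l := B :: l) (by omega) hA hE hs.1 (by simpa [hl] using hs.2) ?_
    rw [hk]
    exact fun P hPj hPk _ => eq_zero_of_ne_one hkN hc hPj hPk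

end BondTerm

open PauliSymbol

/-- The couplings of the Hamiltonian `∑ s, (J₁ X_s Y_{s+1} + J₂ w_s Z_{s+1})`, for a symbol `w`. The
Hamiltonian `hamiltonian2` is the case `w = Y`, and `hamiltonian3` becomes the case `w = Z` after a
cyclic permutation of the axes. -/
noncomputable def couplings (w : PauliSymbol) (J₁ J₂ : ℝ) (A B : PauliSymbol) : ℝ :=
  (if A = X ∧ B = Y then J₁ else 0) + if A = w ∧ B = Z then J₂ else 0

section Couplings

variable {N : ℕ} {w : PauliSymbol} {J₁ J₂ : ℝ}

theorem sum_couplings_smul {M : Type*} [AddCommGroup M] [Module ℝ M]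
    (F : PauliSymbol → PauliSymbol → M) :
    ∑ A, ∑ B, couplings w J₁ J₂ A B • F A B = J₁ • F X Y + J₂ • F w Z := by
  simp only [couplings, add_smul, ite_and, ite_smul, zero_smul, Finset.sum_add_distrib,
    Finset.sum_ite_irrel, Finset.sum_ite_eq', Finset.mem_univ, if_true, Finset.sum_const_zero]

theorem sum_couplings_mul (F : PauliSymbol → PauliSymbol → ℝ) :
    ∑ A, ∑ B, couplings w J₁ J₂ A B * F A B = J₁ * F X Y + J₂ * F w Z :=
  sum_couplings_smul F

theorem sum_couplings_right (e : PauliSymbol) (F : PauliSymbol → ℝ) :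
    ∑ u, couplings w J₁ J₂ u e * F u =
      (if e = Y then J₁ * F X else 0) + if e = Z then J₂ * F w else 0 := by
  simp only [couplings, add_mul, ite_and, ite_mul, zero_mul, Finset.sum_add_distrib,
    Finset.sum_ite_eq', Finset.mem_univ, if_true]

variable {c : Config N → ℝ}

theorem couplings_X_of_ne (hw : w ≠ X) {e : PauliSymbol} (he : e ≠ Y) :
    couplings w J₁ J₂ X e = 0 := by
  simp [couplings, hw.symm, he]

theorem couplings_right_of_ne (hw : w ≠ X) {e : PauliSymbol} (he : e ≠ Z) :
    couplings w J₁ J₂ w e = 0 := by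
  simp [couplings, hw, he]

theorem leftTerm_couplings_X (hw : w ≠ X) (j : ZMod N) (B : PauliSymbol) (l : List PauliSymbol) :
    leftTerm (couplings w J₁ J₂) c j X (B :: l) =
      J₁ * Y.sgn B * c (place (j + 1) ((B * Y) :: l)) := by
  rw [leftTerm_eq_single fun _ => couplings_X_of_ne hw]
  simp [couplings]

theorem leftTerm_couplings_right (hw : w ≠ X) (j : ZMod N) (B : PauliSymbol)
    (l : List PauliSymbol) :
    leftTerm (couplings w J₁ J₂) c j w (B :: l) =
      J₂ * Z.sgn B * c (place (j + 1) ((B * Z) :: l)) := by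
  rw [leftTerm_eq_single fun _ => couplings_right_of_ne hw]
  simp [couplings]

theorem leftTerm_couplings_of_ne {A : PauliSymbol} (hX : A ≠ X) (hw : A ≠ w) (j : ZMod N)
    (l : List PauliSymbol) : leftTerm (couplings w J₁ J₂) c j A l = 0 := by
  cases l with
  | nil => rfl
  | cons B l => exact leftTerm_eq_zero fun e he => absurd (by simp [couplings, hX, hw]) he

end Couplings

/-- `c` solves the stationarity equations of the couplings `J₁ X ⊗ Y + J₂ w ⊗ Z` and is supported on
strings of length at most `k`. -/
structure IsLocalStationary {N : ℕ} [NeZero N] (w : PauliSymbol) (J₁ J₂ : ℝ) (k : ℕ)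
    (c : Config N → ℝ) : Prop where
  isStationary : IsStationary (couplings w J₁ J₂) c
  mem_localCoeffs : c ∈ localCoeffs N k
  right_ne_one : w ≠ 1
  right_ne_X : w ≠ X
  left_coupling_ne_zero : J₁ ≠ 0
  right_coupling_ne_zero : J₂ ≠ 0
  two_mul_le : 2 * k ≤ N

/-- Every string of length `k` that begins with the word `P` has coefficient `0`. -/
def IsForbiddenPrefix {N : ℕ} (k : ℕ) (c : Config N → ℝ) (P : List PauliSymbol) : Prop :=
  ∀ j q D, D ≠ 1 → (P ++ (q ++ [D])).length = k → c (place j (P ++ (q ++ [D]))) = 0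

/-- The word `Z ⋯ Z Y` with `n` letters `Z`. -/
def tailWord (n : ℕ) : List PauliSymbol := List.replicate n Z ++ [Y]

theorem length_tailWord (n : ℕ) : (tailWord n).length = n + 1 := by simp [tailWord]

theorem tailWord_succ (n : ℕ) : tailWord (n + 1) = Z :: tailWord n := rfl

namespace IsLocalStationary

variable {N : ℕ} [NeZero N] {w : PauliSymbol} {J₁ J₂ : ℝ} {k n : ℕ} {c : Config N → ℝ}
  {A D : PauliSymbol} {m p r : List PauliSymbol}

theorem extend_X (h : IsLocalStationary w J₁ J₂ k c) (hA : A ≠ 1) (hm : m.length + 2 = k)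
    (j : ZMod N) :
    leftTerm (couplings w J₁ J₂) c j A (m ++ [D * X, Y]) +
      J₁ * (D.sgn X * c (place j (A :: (m ++ [D])))) = 0 := by
  have heq := h.isStationary.leftTerm_add_eq_zero h.two_mul_le h.mem_localCoeffs hA
    (by decide : Y ≠ 1) hm (D := D * X) j
  simpa only [mul_assoc, sum_couplings_right, if_true, if_neg (by decide : Y ≠ Z), add_zero,
    sgn_mul_self, mul_self, mul_one] using heq

theorem extend_right (h : IsLocalStationary w J₁ J₂ k c) (hA : A ≠ 1) (hm : m.length + 2 = k)
    (j : ZMod N) :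
    leftTerm (couplings w J₁ J₂) c j A (m ++ [D * w, Z]) +
      J₂ * (D.sgn w * c (place j (A :: (m ++ [D])))) = 0 := by
  have heq := h.isStationary.leftTerm_add_eq_zero h.two_mul_le h.mem_localCoeffs hA
    (by decide : Z ≠ 1) hm (D := D * w) j
  simpa only [mul_assoc, sum_couplings_right, if_true, if_neg (by decide : Z ≠ Y), zero_add,
    sgn_mul_self, mul_self, mul_one] using heq

theorem extend_tail (h : IsLocalStationary w J₁ J₂ k c) (hA : A ≠ 1) {n : ℕ}
    (hp : p.length + n + 2 = k) (j : ZMod N) :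
    leftTerm (couplings w J₁ J₂) c j A (p ++ tailWord (n + 1)) =
      J₁ * c (place j (A :: (p ++ tailWord n))) := by
  have heq := h.extend_X (D := Y) (m := p ++ List.replicate n Z) hA (by simp; omega) j
  have htail : p ++ List.replicate n Z ++ [Y * X, Y] = p ++ tailWord (n + 1) := by
    simp only [tailWord, List.replicate_succ', List.append_assoc]; rfl
  rw [htail, List.append_assoc, ← tailWord, show Y.sgn X = -1 from rfl] at heq
  push_cast at heq
  linarith

theorem eq_zero_of_leftTerm (h : IsLocalStationary w J₁ J₂ k c) (hA : A ≠ 1) (hD : D ≠ 1)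
    (hm : m.length + 2 = k) {j : ZMod N}
    (hleft : ∀ F E, E ≠ 1 → leftTerm (couplings w J₁ J₂) c j A (m ++ [F, E]) = 0) :
    c (place j (A :: (m ++ [D]))) = 0 := by
  by_cases hDX : D = X
  · have heq := h.extend_right (D := D) hA hm j
    rw [hleft _ Z (by decide), zero_add] at heq
    have hsgn := sgn_ne_zero hD h.right_ne_one (hDX.trans_ne h.right_ne_X.symm)
    simpa [h.right_coupling_ne_zero, hsgn] using heq
  · have heq := h.extend_X (D := D) hA hm j
    rw [hleft _ Y (by decide), zero_add] at heq
    have hsgn := sgn_ne_zero hD (by decide) hDX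
    simpa [h.left_coupling_ne_zero, hsgn] using heq

theorem isForbiddenPrefix_singleton (h : IsLocalStationary w J₁ J₂ k c) (hA : A ≠ 1) (hX : A ≠ X)
    (hw : A ≠ w) : IsForbiddenPrefix k c [A] := fun j q D hD hlen =>
  h.eq_zero_of_leftTerm hA hD (by simpa using hlen) fun _ _ _ =>
    leftTerm_couplings_of_ne hX hw j _

theorem isForbiddenPrefix_cons (h : IsLocalStationary w J₁ J₂ k c) (hA : A ≠ 1) {B : PauliSymbol}
    (hB : ∀ e, couplings w J₁ J₂ A e ≠ 0 → B ≠ 1 → B ≠ e →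
      IsForbiddenPrefix k c ((B * e) :: p)) : IsForbiddenPrefix k c (A :: B :: p) := by
  intro j q D hD hlen
  simp only [List.length_append, List.length_cons, List.length_nil] at hlen
  rw [List.cons_append, List.cons_append, ← List.append_assoc, ← List.cons_append]
  refine h.eq_zero_of_leftTerm hA hD (by simp; omega) fun F E hE => ?_
  refine leftTerm_eq_zero fun e hJ hB1 hBe => ?_
  simpa using hB e hJ hB1 hBe (j + 1) (q ++ [F]) E hE (by simp; omega)

theorem isForbiddenPrefix_hole (h : IsLocalStationary w J₁ J₂ k c) (hA : A ≠ 1)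
    (p : List PauliSymbol) : IsForbiddenPrefix k c (A :: (p ++ [1])) := by
  induction p generalizing A with
  | nil => exact h.isForbiddenPrefix_cons hA fun _ _ h1 => absurd rfl h1
  | cons B p ih => exact h.isForbiddenPrefix_cons hA fun e _ _ hBe => ih (mul_eq_one.not.2 hBe)

theorem eq_zero_of_hole (h : IsLocalStationary w J₁ J₂ k c) {P : Config N} {a : ZMod N}
    (ha : P a ≠ 1) (hak : P (a + (k - 1 : ℕ)) ≠ 1) {d : ℕ} (hd : 1 ≤ d) (hdk : d + 2 ≤ k)
    (hhole : P (a + d) = 1) : c P = 0 := by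
  have hkN := h.two_mul_le
  by_contra hP
  obtain ⟨A, m, D, hA, hD, hm, rfl⟩ := exists_word (by omega) hkN h.mem_localCoeffs hP ha hak
  obtain ⟨i, rfl⟩ := Nat.exists_eq_add_of_le' hd
  have him : i < m.length := by omega
  have hget : m[i] = 1 := by
    rw [place_apply (by simp; omega) a (by omega)] at hhole
    simpa [List.getElem?_append_left him, List.getElem?_eq_getElem him] using hhole
  have hsplit : A :: (m ++ [D]) = A :: (m.take i ++ [1]) ++ (m.drop (i + 1) ++ [D]) := by
    conv_lhs => rw [← List.take_append_drop i m, List.drop_eq_getElem_cons him, hget]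
    simp
  rw [hsplit] at hP
  refine hP (h.isForbiddenPrefix_hole hA _ a _ D hD ?_)
  rw [← hsplit]
  simpa using hm

theorem leadingCoeff_eq (h : IsLocalStationary w J₁ J₂ k c) (hn : n + 2 = k) (i j : ZMod N) :
    c (place i (X :: tailWord n)) = c (place j (X :: tailWord n)) := by
  refine apply_eq_of_add_one_eq (f := fun j => c (place j (X :: tailWord n))) (fun j => ?_) i j
  have heq := h.extend_tail (A := X) (p := []) (by decide) (by simpa) j
  rw [List.nil_append, tailWord_succ, leftTerm_couplings_X h.right_ne_X, mul_assoc] at heq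
  simpa [sgn, show Z * Y = X from rfl] using mul_left_cancel₀ h.left_coupling_ne_zero heq

theorem eq_zero_of_leftTerm_tail (h : IsLocalStationary w J₁ J₂ k c) (hA : A ≠ 1)
    (hp : p.length + n + 2 = k) {j : ZMod N}
    (hleft : leftTerm (couplings w J₁ J₂) c j A (p ++ tailWord (n + 1)) = 0) :
    c (place j (A :: (p ++ tailWord n))) = 0 := by
  rw [h.extend_tail hA hp] at hleft
  exact (mul_eq_zero.1 hleft).resolve_left h.left_coupling_ne_zero

theorem tail_eq_zero_of_leadingCoeff (h : IsLocalStationary w J₁ J₂ k c)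
    (hlead : ∀ j n, n + 2 = k → c (place j (X :: tailWord n)) = 0) (hA : A ≠ 1)
    (hp : p.length + n + 2 = k) (j : ZMod N) : c (place j (A :: (p ++ tailWord n))) = 0 := by
  induction p generalizing A n j with
  | nil =>
    rcases eq_or_ne A X with rfl | hX
    · exact hlead j n (by simpa using hp)
    refine h.eq_zero_of_leftTerm_tail hA hp ?_
    rcases eq_or_ne A w with rfl | hw
    · rw [List.nil_append, tailWord_succ, leftTerm_couplings_right hX, sgn_self, Int.cast_zero,
        mul_zero, zero_mul]
    · exact leftTerm_couplings_of_ne hX hw j _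
  | cons B p ih =>
    refine h.eq_zero_of_leftTerm_tail hA hp (leftTerm_eq_zero fun e _ _ hBe => ?_)
    exact ih (mul_eq_one.not.2 hBe) (by simpa [add_assoc, add_comm 1] using hp) (j + 1)

theorem eq_zero_of_leadingCoeff_of_ne_X (h : IsLocalStationary w J₁ J₂ k c)
    (hlead : ∀ j n, n + 2 = k → c (place j (X :: tailWord n)) = 0) (hA : A ≠ 1) (hD : D ≠ 1)
    (hDX : D ≠ X) (hm : m.length + 2 = k) (j : ZMod N) : c (place j (A :: (m ++ [D]))) = 0 := by
  have heq := h.extend_X (D := D) hA hm j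
  rw [leftTerm_append_eq_zero (fun j B p hB hp =>
    h.tail_eq_zero_of_leadingCoeff (n := 0) hlead hB hp j) hm, zero_add] at heq
  simpa [h.left_coupling_ne_zero, sgn_ne_zero hD (by decide) hDX] using heq

theorem eq_zero_of_leadingCoeff (h : IsLocalStationary w J₁ J₂ k c)
    (hlead : ∀ j n, n + 2 = k → c (place j (X :: tailWord n)) = 0) (hA : A ≠ 1) (hD : D ≠ 1)
    (hm : m.length + 2 = k) (j : ZMod N) : c (place j (A :: (m ++ [D]))) = 0 := by
  rcases ne_or_eq D X with hDX | rfl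
  · exact h.eq_zero_of_leadingCoeff_of_ne_X hlead hA hD hDX hm j
  have heq := h.extend_right (D := X) hA hm j
  rw [leftTerm_append_eq_zero (fun j B p hB hp =>
    h.eq_zero_of_leadingCoeff_of_ne_X hlead hB (by decide) (by decide) hp j) hm, zero_add] at heq
  simpa [h.right_coupling_ne_zero, sgn_ne_zero hD h.right_ne_one h.right_ne_X.symm] using heq

theorem right_tail_eq (h : IsLocalStationary w J₁ J₂ k c) (hn : n + 3 = k) (j : ZMod N) :
    J₁ * c (place j (w :: Y :: tailWord n)) = -J₂ * c (place (j + 1) (X :: tailWord (n + 1))) := by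
  have heq := h.extend_tail (n := n) (p := [Y]) h.right_ne_one (by simp; omega) j
  rw [List.cons_append, List.nil_append, leftTerm_couplings_right h.right_ne_X] at heq
  rw [List.cons_append, List.nil_append] at heq
  simpa [sgn, show Y * Z = X from rfl] using heq.symm

theorem bondTerm_eq_zero_of_hole (h : IsLocalStationary w J₁ J₂ k c) (hA : A ≠ 1)
    (hk : p.length + n + 3 = k) (j : ZMod N) {i : ℕ} (hiN : i < N) (hi : i ≠ 0)
    (hip : i ≠ p.length) (hip' : i ≠ p.length + 1) (hik : i + 2 ≠ k) :
    bondTerm (couplings w J₁ J₂) c (place j (A :: (p ++ 1 :: tailWord n))) (j + (i : ZMod N)) =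
      0 := by
  have hkN := h.two_mul_le
  have hinj {i' : ℕ} (hi' : i' < k) (hne : i ≠ i') : j + (i : ZMod N) ≠ j + (i' : ZMod N) :=
    (add_natCast_inj hiN (by omega) j).not.2 hne
  have hword : p ++ 1 :: tailWord n = p ++ 1 :: List.replicate n Z ++ [Y] := by simp [tailWord]
  have hlen : (p ++ 1 :: List.replicate n Z).length + 2 = k := by simp; omega
  rw [hword]
  refine bondTerm_word_eq_zero (by omega) hA (by decide) ?_
    (hinj (i' := (p ++ 1 :: List.replicate n Z).length) (by omega) (by omega))
    fun P hPj hPk hoff => ?_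
  · simpa using hinj (by omega) hi
  refine h.eq_zero_of_hole (d := p.length + 1) hPj ?_ (by omega) (by omega) ?_
  · rwa [show k - 1 = (p ++ 1 :: List.replicate n Z).length + 1 by omega]
  · rw [hoff _ (hinj (by omega) hip').symm, place_apply (by simp; omega) j (by omega)]
    · simp
    · rw [Nat.cast_succ, ← add_assoc]
      exact (add_left_injective 1).ne (hinj (by omega) hip).symm

theorem bondTerm_hole (h : IsLocalStationary w J₁ J₂ k c) (hk : p.length + n + 2 = k)
    (hp : IsForbiddenPrefix k c p) (j : ZMod N) :
    bondTerm (couplings w J₁ J₂) c (place j (p ++ 1 :: tailWord n)) (j + (p.length : ZMod N)) =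
      0 := by
  have hkN := h.two_mul_le
  cases n with
  | zero =>
    rw [tailWord, List.replicate_zero, List.nil_append, bondTerm_place (by simp; omega)]
    refine Finset.sum_eq_zero fun u _ => Finset.sum_eq_zero fun e _ => ?_
    rw [pairSign_one_left]
    rcases eq_or_ne Y e with rfl | he
    · simp [sgn_self]
    · rw [show p ++ [1 * u, Y * e] = p ++ ([1 * u] ++ [Y * e]) from rfl,
        hp j _ _ (mul_eq_one.not.2 he) (by simp; omega), mul_zero]
  | succ n =>
    rw [tailWord_succ, bondTerm_place (by simp [length_tailWord]; omega)]
    refine Finset.sum_eq_zero fun u _ => Finset.sum_eq_zero fun e _ => ?_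
    rw [tailWord, ← List.cons_append, ← List.cons_append,
      hp j _ Y (by decide) (by simp; omega), mul_zero]

theorem bondTerm_hole_last (h : IsLocalStationary w J₁ J₂ k c) (hk : p.length + n + 3 = k)
    (hp : IsForbiddenPrefix k c p) (j : ZMod N) {d : ℕ} (hd : d + 2 = k) :
    bondTerm (couplings w J₁ J₂) c (place j (p ++ 1 :: tailWord (n + 1))) (j + (d : ZMod N)) =
      -J₁ * c (place j (p ++ 1 :: tailWord n)) := by
  have hkN := h.two_mul_le
  have hword : p ++ 1 :: tailWord (n + 1) = (p ++ 1 :: List.replicate n Z) ++ [Z, Y] := by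
    simp [tailWord, List.replicate_succ']
  have hlen : d = (p ++ 1 :: List.replicate n Z).length := by simp; omega
  rw [hword, hlen, bondTerm_last (by omega) fun u e he => ?_]
  · simp only [mul_assoc, sum_couplings_right, if_true, if_neg (by decide : Y ≠ Z), add_zero]
    simp [tailWord, sgn, show Z * X = Y from rfl]
  · simpa using hp j (1 :: (List.replicate n Z ++ [Z * u])) _ he (by simp; omega)

theorem sum_bondTerm_eq_neg_last (h : IsLocalStationary w J₁ J₂ k c) (hA : A ≠ 1)
    (hk : p.length + n + 3 = k) (hp : IsForbiddenPrefix k c (A :: p)) (j : ZMod N) {d : ℕ}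
    (hd : d + 2 = k) :
    ∑ i ∈ Finset.range (p.length + 1), bondTerm (couplings w J₁ J₂) c
        (place j (A :: (p ++ 1 :: tailWord n))) (j + (i : ZMod N)) =
      -bondTerm (couplings w J₁ J₂) c (place j (A :: (p ++ 1 :: tailWord n)))
        (j + (d : ZMod N)) := by
  have hkN := h.two_mul_le
  rw [eq_neg_iff_add_eq_zero, ← h.isStationary (place j (A :: (p ++ 1 :: tailWord n))),
    sum_eq_sum_range _ j, ← Finset.sum_range_add_sum_Ico _ (by omega : p.length + 1 ≤ N)]
  congr 1
  symm
  refine Finset.sum_eq_single_of_mem d (Finset.mem_Ico.2 ⟨by omega, by omega⟩) fun i hi hid => ?_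
  rw [Finset.mem_Ico] at hi
  rcases eq_or_ne i (p.length + 1) with rfl | hip
  · exact h.bondTerm_hole (p := A :: p) (by simp; omega) hp j
  · exact h.bondTerm_eq_zero_of_hole hA hk j hi.2 (by omega) (by omega) hip (by omega)

theorem sum_bondTerm_hole_zero (h : IsLocalStationary w J₁ J₂ k c) (hA : A ≠ 1)
    (hk : p.length + 3 = k) (hp : IsForbiddenPrefix k c (A :: p)) (j : ZMod N) :
    ∑ i ∈ Finset.range (p.length + 1), bondTerm (couplings w J₁ J₂) c
      (place j (A :: (p ++ 1 :: tailWord 0))) (j + (i : ZMod N)) = 0 := by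
  have hlast := h.bondTerm_hole (p := A :: p) (n := 0) (by simp; omega) hp j
  rw [List.length_cons, List.cons_append] at hlast
  rw [h.sum_bondTerm_eq_neg_last hA hk hp j (d := p.length + 1) (by omega), hlast, neg_zero]

theorem sum_bondTerm_hole_succ (h : IsLocalStationary w J₁ J₂ k c) (hA : A ≠ 1)
    (hk : p.length + n + 4 = k) (hp : IsForbiddenPrefix k c (A :: p)) (j : ZMod N) :
    ∑ i ∈ Finset.range (p.length + 1), bondTerm (couplings w J₁ J₂) c
        (place j (A :: (p ++ 1 :: tailWord (n + 1)))) (j + (i : ZMod N)) =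
      J₁ * c (place j (A :: (p ++ 1 :: tailWord n))) := by
  have hd : k - 2 + 2 = k := by omega
  have hlast := h.bondTerm_hole_last (p := A :: p) (n := n) (by simp; omega) hp j hd
  rw [List.cons_append, List.cons_append] at hlast
  rw [h.sum_bondTerm_eq_neg_last hA (by omega) hp j hd, hlast, neg_mul, neg_neg]

theorem isForbiddenPrefix_mul_right (h : IsLocalStationary w J₁ J₂ k c) :
    IsForbiddenPrefix k c [X * w] :=
  h.isForbiddenPrefix_singleton (mul_eq_one.not.2 h.right_ne_X.symm)
    (by simpa using h.right_ne_one) (by simp)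

theorem bondTerm_mul_right (h : IsLocalStationary w J₁ J₂ k c) (hk : n + 3 = k) (j : ZMod N) :
    bondTerm (couplings w J₁ J₂) c (place j ((X * w) :: 1 :: tailWord n)) j =
      2 * J₂ * X.sgn w * c (place j (X :: tailWord (n + 1))) := by
  have hkN := h.two_mul_le
  have hbond := bondTerm_place (J := couplings w J₁ J₂) (c := c) (l₁ := []) (l₂ := tailWord n)
    (by simp [length_tailWord]; omega) j (X * w) 1
  rw [List.length_nil, Nat.cast_zero, add_zero] at hbond
  have hw : X * w * X = w := by rw [mul_comm X w, mul_mul_self]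
  have hsgn : X.sgn (X * w) = -X.sgn w := by rw [mul_comm, sgn_mul_self, sgn_swap]
  simp only [List.nil_append, mul_assoc, sum_couplings_mul, pairSign_one_right, hsgn,
    sgn_mul_self, one_mul] at hbond
  rw [hbond, ← mul_assoc X w X, ← mul_assoc X w w, hw, mul_mul_self,
    ← tailWord_succ]
  have htail := h.right_tail_eq hk j
  rw [h.leadingCoeff_eq (by omega) (j + 1) j] at htail
  push_cast
  linear_combination (-(X.sgn w : ℝ)) * htail

theorem sum_bondTerm_hole_left (h : IsLocalStationary w J₁ J₂ k c) (hA : A ≠ 1)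
    (hk : r.length + n + 4 = k) (j : ZMod N) :
    ∑ i ∈ Finset.range (r.length + 2), bondTerm (couplings w J₁ J₂) c
        (place j (A :: (r ++ X :: 1 :: tailWord n))) (j + (i : ZMod N)) =
      leftTerm (couplings w J₁ J₂) c j A (r ++ X :: 1 :: tailWord n) +
        J₂ * w.sgn X * c (place j (A :: (r ++ (X * w) :: tailWord (n + 1)))) := by
  have hkN := h.two_mul_le
  have hword : r ++ X :: 1 :: tailWord n = (r ++ [X]) ++ 1 :: tailWord n := by simp
  have hfirst : bondTerm (couplings w J₁ J₂) c (place j (A :: (r ++ X :: 1 :: tailWord n))) j =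
      leftTerm (couplings w J₁ J₂) c j A (r ++ X :: 1 :: tailWord n) := by
    obtain ⟨B, l, hBl⟩ := List.exists_cons_of_ne_nil (by simp : r ++ [X] ≠ [])
    have hl : l.length = r.length := by simpa using (congrArg List.length hBl).symm
    rw [hword, hBl, List.cons_append, bondTerm_first (by simp [length_tailWord]; omega)]
    intro u e hu
    simpa [tailWord] using h.isForbiddenPrefix_hole hu ((B * e) :: l) j (List.replicate n Z) Y
      (by decide) (by simp; omega)
  have hlast : bondTerm (couplings w J₁ J₂) c (place j (A :: (r ++ X :: 1 :: tailWord n)))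
      (j + ((r.length + 1 : ℕ) : ZMod N)) =
        J₂ * w.sgn X * c (place j (A :: (r ++ (X * w) :: tailWord (n + 1)))) := by
    rw [← List.cons_append, ← List.length_cons (a := A),
      bondTerm_place (by simp [length_tailWord]; omega)]
    simp only [mul_assoc, sum_couplings_mul, pairSign_one_right, sgn_self, one_mul,
      Int.cast_zero, zero_mul, mul_zero, zero_add, List.cons_append, tailWord_succ]
  rw [Finset.sum_range_succ, hlast, Finset.sum_range_succ', Nat.cast_zero, add_zero, hfirst,
    Finset.sum_eq_zero, zero_add]
  intro i hi
  rw [Finset.mem_range] at hi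
  rw [hword]
  exact h.bondTerm_eq_zero_of_hole hA (by simp; omega) j (by omega) (by omega) (by simp; omega)
    (by simp; omega) (by omega)

end IsLocalStationary

section Front

/-- A word `A :: r` to which the equations of the strings `A r X 1 Z ⋯ Z Y` apply: the strings that
begin with `A r X` have coefficient `0`, and the strings whose hole has moved through `A r` have
accumulated `r.length + 2` equal contributions, proportional to the coefficient of
`A r (X w) Z ⋯ Z Y`. -/
structure IsFront {N : ℕ} (w : PauliSymbol) (J₁ J₂ : ℝ) (k : ℕ) (c : Config N → ℝ)
    (A : PauliSymbol) (r : List PauliSymbol) : Prop where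
  ne_one : A ≠ 1
  ne_Y : A ≠ Y
  isForbiddenPrefix : IsForbiddenPrefix k c (A :: (r ++ [X]))
  filled_ne_zero : ∀ j n, r.length + n + 4 = k →
    c (place j (A :: (r ++ (X * w) :: tailWord (n + 1)))) ≠ 0
  leftTerm_eq : ∀ j n, r.length + n + 4 = k →
    leftTerm (couplings w J₁ J₂) c j A (r ++ X :: 1 :: tailWord n) =
      (r.length + 2) * (J₂ * w.sgn X * c (place j (A :: (r ++ (X * w) :: tailWord (n + 1)))))

variable {N : ℕ} [NeZero N] {w : PauliSymbol} {J₁ J₂ : ℝ} {k n : ℕ} {c : Config N → ℝ}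
  {A : PauliSymbol} {r : List PauliSymbol}

theorem IsLocalStationary.filled_succ (h : IsLocalStationary w J₁ J₂ k c)
    (hk : r.length + n + 5 = k) (j : ZMod N) :
    c (place j (X :: (A * Y) :: (r ++ (X * w) :: tailWord (n + 1)))) =
      A.sgn Y * c (place (j + 1) (A :: (r ++ (X * w) :: tailWord (n + 2)))) := by
  have heq := h.extend_tail (A := X) (p := (A * Y) :: (r ++ [X * w])) (n := n + 1) (by decide)
    (by simp; omega) j
  rw [List.cons_append, leftTerm_couplings_X h.right_ne_X, mul_assoc, sgn_mul_self, mul_mul_self]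
    at heq
  simpa using (mul_left_cancel₀ h.left_coupling_ne_zero heq).symm

namespace IsFront

theorem sum_bondTerm (hr : IsFront w J₁ J₂ k c A r) (h : IsLocalStationary w J₁ J₂ k c)
    (hk : r.length + n + 4 = k) (j : ZMod N) :
    ∑ i ∈ Finset.range (r.length + 2), bondTerm (couplings w J₁ J₂) c
        (place j (A :: (r ++ X :: 1 :: tailWord n))) (j + (i : ZMod N)) =
      (r.length + 3) * (J₂ * w.sgn X * c (place j (A :: (r ++ (X * w) :: tailWord (n + 1))))) := by
  rw [h.sum_bondTerm_hole_left hr.ne_one hk, hr.leftTerm_eq j n hk]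
  ring

theorem length_add_four_ne (hr : IsFront w J₁ J₂ k c A r) (h : IsLocalStationary w J₁ J₂ k c) :
    r.length + 4 ≠ k := by
  intro hk
  have hzero := h.sum_bondTerm_hole_zero (p := r ++ [X]) hr.ne_one (by simpa) hr.isForbiddenPrefix 0
  have hsum := hr.sum_bondTerm h (n := 0) hk 0
  rw [List.length_append, List.append_assoc] at hzero
  have hprod := hsum.symm.trans hzero
  have hsgn := sgn_ne_zero h.right_ne_one (by decide : X ≠ 1) h.right_ne_X
  have hlen : (r.length + 3 : ℝ) ≠ 0 := by positivity
  simp [h.right_coupling_ne_zero, hsgn, hlen, hr.filled_ne_zero 0 0 hk] at hprod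

theorem mul_coeff_eq (hr : IsFront w J₁ J₂ k c A r) (h : IsLocalStationary w J₁ J₂ k c)
    (hk : r.length + n + 5 = k) (j : ZMod N) :
    J₁ * c (place j (A :: (r ++ X :: 1 :: tailWord n))) =
      (r.length + 3) * (J₂ * w.sgn X * c (place j (A :: (r ++ (X * w) :: tailWord (n + 2))))) := by
  have hsucc := h.sum_bondTerm_hole_succ (p := r ++ [X]) (n := n) hr.ne_one (by simp; omega)
    hr.isForbiddenPrefix j
  rw [List.length_append, List.append_assoc, List.append_assoc] at hsucc
  exact hsucc.symm.trans (hr.sum_bondTerm h (by omega) j)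

theorem succ (hr : IsFront w J₁ J₂ k c A r) (h : IsLocalStationary w J₁ J₂ k c) :
    IsFront w J₁ J₂ k c X ((A * Y) :: r) where
  ne_one := by decide
  ne_Y := by decide
  isForbiddenPrefix := by
    refine h.isForbiddenPrefix_cons (by decide) fun e he _ _ => ?_
    obtain rfl : e = Y := not_not.1 fun hY => he (couplings_X_of_ne h.right_ne_X hY)
    rw [mul_mul_self]
    exact hr.isForbiddenPrefix
  filled_ne_zero j n hk := by
    rw [List.length_cons] at hk
    rw [List.cons_append, h.filled_succ (by omega)]
    exact mul_ne_zero (Int.cast_ne_zero.2 (sgn_ne_zero hr.ne_one (by decide) hr.ne_Y))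
      (hr.filled_ne_zero _ (n + 1) (by omega))
  leftTerm_eq j n hk := by
    rw [List.length_cons] at hk
    rw [List.cons_append, leftTerm_couplings_X h.right_ne_X, sgn_mul_self, mul_mul_self,
      mul_right_comm, hr.mul_coeff_eq h (by omega), List.cons_append, h.filled_succ (by omega),
      List.length_cons]
    push_cast
    ring

end IsFront

namespace IsLocalStationary

theorem exists_coupling_right (h : IsLocalStationary w J₁ J₂ k c) :
    ∃ u, u ≠ 1 ∧ u ≠ Y ∧ couplings w J₁ J₂ u w ≠ 0 ∧ ∀ e, e ≠ w → couplings w J₁ J₂ u e = 0 := by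
  have hw : w = Y ∨ w = Z := by
    have hX := h.right_ne_X
    have h1 := h.right_ne_one
    cases w <;> tauto
  rcases hw with rfl | rfl
  · exact ⟨X, by decide, by decide, by simpa [couplings] using h.left_coupling_ne_zero,
      fun _ => couplings_X_of_ne h.right_ne_X⟩
  · exact ⟨Z, by decide, by decide, by simpa [couplings] using h.right_coupling_ne_zero,
      fun _ => couplings_right_of_ne h.right_ne_X⟩

theorem isFront_singleton (h : IsLocalStationary w J₁ J₂ k c)
    (hlead : ∀ j n, n + 2 = k → c (place j (X :: tailWord n)) ≠ 0) {u : PauliSymbol}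
    (hu : u ≠ 1) (huY : u ≠ Y) (huw : couplings w J₁ J₂ u w ≠ 0)
    (hue : ∀ e, e ≠ w → couplings w J₁ J₂ u e = 0) : IsFront w J₁ J₂ k c u [] := by
  have hfilled (j : ZMod N) {n : ℕ} (hk : n + 4 = k) :
      J₁ * c (place j (u :: (X * w) :: tailWord (n + 1))) =
        couplings w J₁ J₂ u w * X.sgn w * c (place (j + 1) (X :: tailWord (n + 2))) := by
    have heq := h.extend_tail (p := [X * w]) (n := n + 1) hu (by simp; omega) j
    rw [List.cons_append, leftTerm_eq_single hue, sgn_mul_self, mul_mul_self] at heq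
    exact heq.symm
  refine ⟨hu, huY, ?_, fun j n hk hzero => ?_, fun j n hk => ?_⟩
  · refine h.isForbiddenPrefix_cons hu fun e he _ _ => ?_
    obtain rfl : e = w := not_not.1 fun hew => he (hue e hew)
    exact h.isForbiddenPrefix_mul_right
  · have hprod := hfilled j (n := n) (by simpa using hk)
    rw [List.nil_append] at hzero
    have hsgn := sgn_ne_zero (by decide) h.right_ne_one h.right_ne_X.symm
    simp [hzero, huw, hsgn, hlead (j + 1) (n + 2) (by simpa using hk)] at hprod
  · replace hk : n + 4 = k := by simpa using hk
    have hsucc := h.sum_bondTerm_hole_succ (p := []) (n := n)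
      (mul_eq_one.not.2 h.right_ne_X.symm) (by simpa) h.isForbiddenPrefix_mul_right (j + 1)
    rw [List.length_nil, zero_add, Finset.sum_range_one, Nat.cast_zero, add_zero, List.nil_append,
      List.nil_append, h.bondTerm_mul_right (by omega)] at hsucc
    have hfill := hfilled j hk
    rw [List.nil_append, leftTerm_eq_single hue, List.nil_append, List.length_nil]
    refine mul_left_cancel₀ h.left_coupling_ne_zero ?_
    push_cast
    linear_combination (-(couplings w J₁ J₂ u w) * w.sgn X) * hsucc - 2 * J₂ * w.sgn X * hfill

theorem exists_isFront (h : IsLocalStationary w J₁ J₂ k c)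
    (hlead : ∀ j n, n + 2 = k → c (place j (X :: tailWord n)) ≠ 0) (i : ℕ) :
    ∃ A r, r.length = i ∧ IsFront w J₁ J₂ k c A r := by
  induction i with
  | zero =>
    obtain ⟨u, hu, huY, huw, hue⟩ := h.exists_coupling_right
    exact ⟨u, [], rfl, h.isFront_singleton hlead hu huY huw hue⟩
  | succ i ih =>
    obtain ⟨A, r, rfl, hr⟩ := ih
    exact ⟨X, _, List.length_cons, hr.succ h⟩

theorem leadingCoeff_eq_zero (h : IsLocalStationary w J₁ J₂ k c) (hk : 3 ≤ k) (j : ZMod N)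
    (hn : n + 2 = k) : c (place j (X :: tailWord n)) = 0 := by
  by_contra hne
  have hlead (i : ZMod N) (m : ℕ) (hm : m + 2 = k) : c (place i (X :: tailWord m)) ≠ 0 := by
    rwa [h.leadingCoeff_eq hm i j, show m = n by omega]
  rcases eq_or_lt_of_le hk with rfl | hk
  · have hzero := h.sum_bondTerm_hole_zero (p := []) (mul_eq_one.not.2 h.right_ne_X.symm) rfl
      h.isForbiddenPrefix_mul_right 0
    rw [List.length_nil, zero_add, Finset.sum_range_one, Nat.cast_zero, add_zero, List.nil_append,
      h.bondTerm_mul_right rfl] at hzero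
    have hsgn := sgn_ne_zero (by decide) h.right_ne_one h.right_ne_X.symm
    simp [h.right_coupling_ne_zero, hsgn, hlead 0 1 rfl] at hzero
  · obtain ⟨A, r, hr, hfront⟩ := h.exists_isFront hlead (k - 4)
    exact hfront.length_add_four_ne h (by omega)

end IsLocalStationary

end Front

namespace IsLocalStationary

variable {N : ℕ} [NeZero N] {w : PauliSymbol} {J₁ J₂ : ℝ} {k : ℕ} {c : Config N → ℝ}

theorem bondTerm_pair (h : IsLocalStationary w J₁ J₂ 1 c) (hN : 3 ≤ N) {A B : PauliSymbol}
    (hA : A ≠ 1) (hB : B ≠ 1) (j : ZMod N) :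
    J₁ * (X.pairSign Y A B * c (place j [A * X, B * Y])) +
      J₂ * (w.pairSign Z A B * c (place j [A * w, B * Z])) = 0 := by
  have hbond := bondTerm_place (J := couplings w J₁ J₂) (c := c) (l₁ := []) (l₂ := [])
    (by simp; omega) j A B
  simp only [List.length_nil, Nat.cast_zero, add_zero, List.nil_append, mul_assoc,
    sum_couplings_mul] at hbond
  rw [← hbond, ← h.isStationary (place j [A, B])]
  refine (Fintype.sum_eq_single j fun s hs => ?_).symm
  exact bondTerm_word_eq_zero (l := []) (by simpa) hA hB hs (by simpa) fun P hPj hPk _ =>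
    eq_zero_of_ne_one h.two_mul_le h.mem_localCoeffs hPj hPk

theorem eq_zero_of_one_site (h : IsLocalStationary w J₁ J₂ 1 c) (hN : 3 ≤ N) {A : PauliSymbol}
    (hA : A ≠ 1) (j : ZMod N) : c (place j [A]) = 0 := by
  have hpair {A B : PauliSymbol} (hA : A ≠ 1) (hB : B ≠ 1) (j : ZMod N) :
      c (place j [A, B]) = 0 :=
    eq_zero_of_length_eq_succ (l := []) h.two_mul_le h.mem_localCoeffs hA hB rfl j
  have hlast (A : PauliSymbol) (j : ZMod N) : c (place j [A, 1]) = c (place j [A]) :=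
    congrArg c (place_append_one j [A])
  have hw := h.right_ne_one
  have hwX := h.right_ne_X
  have hXw : X * w ≠ 1 := mul_eq_one.not.2 hwX.symm
  have hsgn : X.sgn w ≠ 0 := sgn_ne_zero (by decide) hw hwX.symm
  have hX (j : ZMod N) : c (place j [X]) = 0 := by
    have heq := h.bondTerm_pair hN hXw (by decide : Z ≠ 1) j
    rw [mul_mul_self, mul_comm X w, mul_mul_self, mul_self Z, hlast,
      hpair hw (by decide : Z * Y ≠ 1), pairSign_self_right, mul_comm w X, sgn_mul_self] at heq
    simpa [h.right_coupling_ne_zero, hsgn] using heq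
  have hright (j : ZMod N) : c (place j [w]) = 0 := by
    have heq := h.bondTerm_pair hN hXw (by decide : Y ≠ 1) j
    rw [mul_mul_self, mul_comm X w, mul_mul_self, mul_self Y, hlast,
      hpair (by decide : X ≠ 1) (by decide : Y * Z ≠ 1), pairSign_self_right, sgn_mul_self,
      sgn_swap] at heq
    simpa [h.left_coupling_ne_zero, hsgn] using heq
  have hthird (j : ZMod N) : c (place j [X * w]) = 0 := by
    have heq := h.bondTerm_pair hN hw (by decide : Y ≠ 1) j
    rw [mul_self, mul_self, hlast, place_one_cons, show Y * Z = X from rfl, hX,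
      pairSign_self_right, mul_comm w X] at heq
    simpa [h.left_coupling_ne_zero, hsgn] using heq
  rcases eq_or_eq_or_eq_mul (by decide : X ≠ 1) hw hwX.symm hA with rfl | rfl | rfl
  exacts [hX j, hright j, hthird j]

theorem eq_zero (h : IsLocalStationary w J₁ J₂ k c) (hN : 3 ≤ N) (h1 : c 1 = 0)
    (hXY : c (place 0 [X, Y]) = 0) : c = 0 := by
  induction k with
  | zero =>
    funext P
    by_contra hP
    obtain ⟨a, l, hl, rfl⟩ := SpinChain.mem_localCoeffs.1 h.mem_localCoeffs P hP
    rw [List.length_eq_zero_iff.1 (Nat.le_zero.1 hl)] at hP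
    exact hP h1
  | succ k ih =>
    refine ih { h with mem_localCoeffs := ?_, two_mul_le := by have := h.two_mul_le; omega }
    rcases k with - | k
    · refine SpinChain.mem_localCoeffs.2 fun P hP => ?_
      obtain ⟨a, l, hl, rfl⟩ := SpinChain.mem_localCoeffs.1 h.mem_localCoeffs P hP
      match l, hl with
      | [], _ => exact ⟨a, [], le_rfl, rfl⟩
      | [A], _ =>
        rcases eq_or_ne A 1 with rfl | hA
        · exact ⟨a + 1, [], le_rfl, (place_one_cons a []).symm⟩
        · exact absurd (h.eq_zero_of_one_site hN hA a) hP
    · refine mem_localCoeffs_pred (by omega) h.mem_localCoeffs fun j A m D hA hD hm =>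
        h.eq_zero_of_leadingCoeff (fun i n hn => ?_) hA hD hm j
      rcases n with - | n
      · rw [h.leadingCoeff_eq hn i 0]
        exact hXY
      · exact h.leadingCoeff_eq_zero (by omega) i hn

end IsLocalStationary

section Assembly

variable {N k : ℕ} {J : PauliSymbol → PauliSymbol → ℝ}

theorem place_pair_inj (hN : 3 ≤ N) {A B A' B' : PauliSymbol} (hA : A ≠ 1) (hB : B ≠ 1)
    {s t : ZMod N} (h : place s [A', B'] = place t [A, B]) : s = t ∧ A' = A ∧ B' = B := by
  have hfirst : place s [A', B'] t = A := by rw [h, place_pair_left (by omega)]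
  have hlast : place s [A', B'] (t + 1) = B := by rw [h, place_pair_right (by omega)]
  have hst : s = t := by
    by_contra hst
    have hts : t = s + 1 := by
      by_contra hts
      exact hA (hfirst.symm.trans (place_pair_of_ne A' B' (Ne.symm hst) hts))
    refine hB (hlast.symm.trans (place_pair_of_ne A' B' ?_ ?_))
    · have := (add_natCast_inj (by omega : 2 < N) (by omega : 0 < N) s).not.2 (by simp)
      rw [hts, add_assoc, one_add_one_eq_two]
      simpa using this
    · exact fun hs => hst (add_right_cancel hs).symm
  subst hst
  rw [place_pair_left (by omega)] at hfirst
  rw [place_pair_right (by omega)] at hlast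
  exact ⟨rfl, hfirst, hlast⟩

variable [NeZero N]

theorem nnCoeff_place_pair (hN : 3 ≤ N) {A B : PauliSymbol} (hA : A ≠ 1) (hB : B ≠ 1)
    (t : ZMod N) : nnCoeff N J (place t [A, B]) = J A B := by
  have hterm (s : ZMod N) (A' B' : PauliSymbol) (h : ¬(s = t ∧ A' = A ∧ B' = B)) :
      J A' B' * (Pi.single (place s [A', B']) 1 : Config N → ℝ) (place t [A, B]) = 0 := by
    rw [Pi.single_eq_of_ne' fun heq => h (place_pair_inj hN hA hB heq), mul_zero]
  simp only [nnCoeff, Finset.sum_apply, Pi.smul_apply, smul_eq_mul]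
  rw [Fintype.sum_eq_single t fun s hs => Finset.sum_eq_zero fun A' _ =>
      Finset.sum_eq_zero fun B' _ => hterm s A' B' fun h => hs h.1,
    Fintype.sum_eq_single A fun A' hA' => Finset.sum_eq_zero fun B' _ =>
      hterm t A' B' fun h => hA' h.2.1,
    Fintype.sum_eq_single B fun B' hB' => hterm t A B' fun h => hB' h.2.2,
    Pi.single_eq_same, mul_one]

theorem nnCoeff_mem_localCoeffs : nnCoeff N J ∈ localCoeffs N 2 :=
  sum_mem fun s _ => sum_mem fun _ _ => sum_mem fun _ _ =>
    Submodule.smul_mem _ _ (single_place_mem_localCoeffs (l := [_, _]) le_rfl s)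

theorem lie_nnHamiltonian_eq_zero {Q : Operator N} (a b : ℝ) (h : ⁅Q, nnHamiltonian N J⁆ = 0) :
    ⁅Q - a • nnHamiltonian N J - b • 1, nnHamiltonian N J⁆ = 0 := by
  rw [← commute_iff_lie_eq] at h ⊢
  exact (h.sub_left ((Commute.refl _).smul_left a)).sub_left ((Commute.one_left _).smul_left b)

theorem exists_eq_of_forall_eq_zero (hN : 3 ≤ N) (hk : 2 * k ≤ N) {A B : PauliSymbol}
    (hA : A ≠ 1) (hB : B ≠ 1) (hJ : J A B ≠ 0)
    (hzero : ∀ c, IsStationary J c → c ∈ localCoeffs N k → c 1 = 0 → c (place 0 [A, B]) = 0 →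
      c = 0)
    {Q : Operator N} (hQ : IsLocalConserved k (nnHamiltonian N J) Q) :
    ∃ a b : ℝ, Q = (a : ℂ) • nnHamiltonian N J + (b : ℂ) • (1 : Operator N) := by
  obtain ⟨hlocal, hlie⟩ := hQ
  obtain ⟨c, hc, rfl⟩ := hlocal.mem_map_localCoeffs (by omega)
  set a := c (place 0 [A, B]) / J A B with ha
  set b := (c - a • nnCoeff N J) 1
  set d := c - a • nnCoeff N J - b • Pi.single 1 1 with hd
  have hpair : place 0 [A, B] ≠ (1 : Config N) := fun h =>
    hA (by rw [← place_pair_left (by omega) A B (0 : ZMod N), h, Pi.one_apply])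
  have htoOp : toOp d = toOp c - a • nnHamiltonian N J - b • 1 := by
    rw [hd, map_sub, map_sub, map_smul, map_smul, toOp_nnCoeff (by omega), toOp_single,
      pauliOp_one]
  have hH : a • nnCoeff N J ∈ localCoeffs N k := by
    rcases le_or_gt 2 k with hk2 | hk2
    · exact Submodule.smul_mem _ _ (localCoeffs_mono hk2 nnCoeff_mem_localCoeffs)
    · have hAB : c (place 0 [A, B]) = 0 := eq_zero_of_length_eq_succ (k := 1) (l := [])
        (by omega) (localCoeffs_mono (by omega) hc) hA hB rfl 0
      rw [ha, hAB, zero_div, zero_smul]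
      exact zero_mem _
  have hdzero : d = 0 := by
    refine hzero d ?_ (sub_mem (sub_mem hc hH) (Submodule.smul_mem _ _ ?_)) ?_ ?_
    · refine .of_lie_eq_zero (by omega) ?_
      rw [htoOp]
      exact lie_nnHamiltonian_eq_zero a b hlie
    · exact single_place_mem_localCoeffs (l := []) k.zero_le 0
    · rw [hd, Pi.sub_apply, Pi.smul_apply, Pi.single_eq_same, smul_eq_mul, mul_one, sub_self]
    · simp [hd, nnCoeff_place_pair hN hA hB, hpair, ha, hJ]
  rw [hdzero, map_zero, sub_sub, eq_comm, sub_eq_zero] at htoOp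
  exact ⟨a, b, htoOp⟩

end Assembly

section Symmetry

variable {N k : ℕ} {f : PauliSymbol ≃* PauliSymbol}

theorem comp_mem_localCoeffs {c : Config N → ℝ} (hc : c ∈ localCoeffs N k) :
    (fun P => c (f ∘ P)) ∈ localCoeffs N k := by
  refine mem_localCoeffs.2 fun P hP => ?_
  obtain ⟨a, l, hl, hP⟩ := mem_localCoeffs.1 hc _ hP
  refine ⟨a, l.map f.symm, by simpa, ?_⟩
  rw [← MulEquiv.coe_toMonoidHom, place_map, hP]
  funext s
  simp

theorem IsStationary.comp [NeZero N] (hf : ∀ A B, (f A).sgn (f B) = A.sgn B)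
    {J : PauliSymbol → PauliSymbol → ℝ} {c : Config N → ℝ}
    (hc : IsStationary (fun A B => J (f.symm A) (f.symm B)) c) :
    IsStationary J fun P => c (f ∘ P) := by
  intro R
  rw [← hc (f ∘ R)]
  refine Fintype.sum_congr _ _ fun s => ?_
  refine Fintype.sum_equiv f.toEquiv _ _ fun A => Fintype.sum_equiv f.toEquiv _ _ fun B => ?_
  have hplace : f ∘ (R * place s [A, B]) = f ∘ R * place s [f A, f B] := by
    rw [show [f A, f B] = [A, B].map f.toMonoidHom from rfl, place_map]
    funext t
    exact map_mul f _ _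
  simp [hplace, PauliSymbol.pairSign, hf]

end Symmetry

section Classification

variable {N k : ℕ} [NeZero N] {w : PauliSymbol} {J₁ J₂ : ℝ}

theorem nnHamiltonian_couplings (f : PauliSymbol ≃* PauliSymbol) :
    nnHamiltonian N (fun A B => couplings w J₁ J₂ (f.symm A) (f.symm B)) =
      ∑ s, (J₁ • (siteOp (f X) s * siteOp (f Y) (s + 1)) +
        J₂ • (siteOp (f w) s * siteOp (f Z) (s + 1))) := by
  refine Fintype.sum_congr _ _ fun s => ?_
  rw [← sum_couplings_smul fun A B => siteOp (f A) s * siteOp (f B) (s + 1)]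
  symm
  refine Fintype.sum_equiv f.toEquiv _ _ fun A => Fintype.sum_equiv f.toEquiv _ _ fun B => ?_
  simp

theorem exists_eq_of_isLocalConserved (hN : 3 ≤ N) (hk : 2 * k ≤ N) (hw : w ≠ 1) (hwX : w ≠ X)
    (h₁ : J₁ ≠ 0) (h₂ : J₂ ≠ 0) {f : PauliSymbol ≃* PauliSymbol}
    (hf : ∀ A B, (f A).sgn (f B) = A.sgn B) {Q : Operator N}
    (hQ : IsLocalConserved k
      (nnHamiltonian N fun A B => couplings w J₁ J₂ (f.symm A) (f.symm B)) Q) :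
    ∃ a b : ℝ, Q =
      (a : ℂ) • nnHamiltonian N (fun A B => couplings w J₁ J₂ (f.symm A) (f.symm B)) +
        (b : ℂ) • (1 : Operator N) := by
  have hone {A : PauliSymbol} (hA : A ≠ 1) : f A ≠ 1 := (map_ne_one_iff f f.injective).2 hA
  refine exists_eq_of_forall_eq_zero hN hk (hone (by decide : X ≠ 1)) (hone (by decide : Y ≠ 1))
    (by simp [couplings, hwX.symm, h₁]) (fun c hc hck h1 hXY => ?_) hQ
  have hzero : (fun P => c (f ∘ P)) = 0 := by
    refine IsLocalStationary.eq_zero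
      ⟨hc.comp hf, comp_mem_localCoeffs hck, hw, hwX, h₁, h₂, hk⟩ hN ?_ ?_
    · rwa [show f ∘ (1 : Config N) = 1 from funext fun _ => map_one f]
    · rwa [← MulEquiv.coe_toMonoidHom, ← place_map]
  funext P
  simpa [← Function.comp_assoc] using congrFun hzero (f.symm ∘ P)

theorem hamiltonian2_eq (Jxy Jyz : ℝ) :
    hamiltonian2 N Jxy Jyz = nnHamiltonian N fun A B =>
      couplings Y Jxy Jyz ((MulEquiv.refl _).symm A) ((MulEquiv.refl _).symm B) := by
  simp only [hamiltonian2, nnHamiltonian_couplings, MulEquiv.refl_apply, Complex.coe_smul]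

/-- The rotation of the spin that permutes the axes cyclically. -/
def rotate : PauliSymbol ≃* PauliSymbol where
  toFun
    | I => I
    | X => Y
    | Y => Z
    | Z => X
  invFun
    | I => I
    | X => Z
    | Y => X
    | Z => Y
  left_inv := by decide
  right_inv := by decide
  map_mul' := by decide

theorem hamiltonian3_eq (Jxx Jyz : ℝ) :
    hamiltonian3 N Jxx Jyz = nnHamiltonian N fun A B =>
      couplings Z Jyz Jxx (rotate.symm A) (rotate.symm B) := by
  simp only [hamiltonian3, nnHamiltonian_couplings, Complex.coe_smul]
  exact Fintype.sum_congr _ _ fun s => add_comm _ _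

end Classification

end SpinChain

theorem theorem3 (N : ℕ) [NeZero N] (hN : 3 ≤ N) (k : ℕ) (hk : (k : ℝ) ≤ (N : ℝ) / 2) :
    (∀ Jxy Jyz : ℝ, Jxy ≠ 0 → Jyz ≠ 0 → ∀ Q : SpinChain.Operator N,
      SpinChain.IsLocalConserved k (SpinChain.hamiltonian2 N Jxy Jyz) Q →
        ∃ a b : ℝ, Q = (a : ℂ) • SpinChain.hamiltonian2 N Jxy Jyz
          + (b : ℂ) • (1 : SpinChain.Operator N)) ∧
    (∀ Jxx Jyz : ℝ, Jxx ≠ 0 → Jyz ≠ 0 → ∀ Q : SpinChain.Operator N,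
      SpinChain.IsLocalConserved k (SpinChain.hamiltonian3 N Jxx Jyz) Q →
        ∃ a b : ℝ, Q = (a : ℂ) • SpinChain.hamiltonian3 N Jxx Jyz
          + (b : ℂ) • (1 : SpinChain.Operator N)) := by
  have hkN : 2 * k ≤ N := by
    rw [le_div_iff₀ two_pos] at hk
    exact_mod_cast (mul_comm _ _).trans_le hk
  refine ⟨fun Jxy Jyz hxy hyz Q hQ => ?_, fun Jxx Jyz hxx hyz Q hQ => ?_⟩
  · rw [SpinChain.hamiltonian2_eq] at hQ ⊢
    exact SpinChain.exists_eq_of_isLocalConserved hN hkN (by decide) (by decide) hxy hyz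
      (fun _ _ => rfl) hQ
  · rw [SpinChain.hamiltonian3_eq] at hQ ⊢
    exact SpinChain.exists_eq_of_isLocalConserved hN hkN (by decide) (by decide) hyz hxx
      (by decide) hQ
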